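/- **Theorem 2.3.** Let $p(y\mid\theta)=q(y)\exp\{y\theta-b(\theta)\}$, $\theta\in\Theta$, be a one-parameter exponential family of probability densities with respect to a fixed measure on $\mathbb R$, where $\Theta\subseteq\mathbb R$ is open and the family does not consist of point masses. Consider the GLM with canonical link (and dispersion $1$): for a data set $D=(n,Y,X)$ with responses $y_i$, $q(y_i)>0$, and covariates $x_i\in\mathbb R^p$ (the rows of $X$), the likelihood is $$L(\beta\mid D)=\prod_{i=1}^n q(y_i)\exp\{y_i x_i'\beta-b(x_i'\beta)\},\qquad \beta\in B,$$ where the parameter space $B\subseteq\mathbb R^p$ is open and convex (for instance $B=\mathbb R^p$) and $x_i'\beta\in\Theta$ for all $\beta\in B$ and all covariates that occur. Let $\pi_0$ be a positive $C^1$ initial prior on $B$, possibly improper. Consider a sequence of current data sets $D=(n,Y,X)$ and historical data sets $D_0=(n_0,Y_0,X_0)$ with $n\to\infty$ and $n_0/n=r$ for a constant $r>0$, such that $X$ and $X_0$ have rank $p$ and $c^*(a_0)=\int_B L(\beta\mid D_0)^{a_0}\pi_0(\beta)\,d\beta<\infty$ for $0<a_0\le1$. For shape parameters $\alpha_0,\beta_0>0$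 the (unnormalized) marginal posterior of $a_0$ under the normalized power prior is $$\pi(a_0\mid D,D_0,\alpha_0,\beta_0)=\int_B L(\beta\mid D)\,\frac{L(\beta\mid D_0)^{a_0}\pi_0(\beta)}{c^*(a_0)}\,\pi(a_0)\,d\beta ,$$ where $\pi(a_0)$ is the $\operatorname{beta}(\alpha_0,\beta_0)$ density (zero outside $(0,1)$). Assume: 1. (Modes.) There are a compact set $K\subset B$ and a vector $\delta\ne0$ such that: for every $n$ in the sequence, $\hat\beta\in K$ solves $\partial_\beta\log L(\beta\mid D)=0$; for every $a_0\in(0,1]$ and all large $n$, $\hat\beta_0=\hat\beta_0(a_0)\in K$ solves $\partial_\beta\log[L(\beta\mid D_0)^{a_0}\pi_0(\beta)/c^*(a_0)]=0$; and for every $a_0\in(0,1]$, $\hat\beta-\hat\beta_0(a_0)\to\delta$ as $n\to\infty$ (in particular this holds if the difference equals $\delta$). 2. (Scaled inverse Hessians.) The matrices $n\left[\frac{\partial^2\log L(\beta\mid D)}{\partial\beta_i\partial\beta_j}\right]^{-1}$ and $n_0a_0\left[\frac{\partial^2\log L(\beta\mid D_0)^{a_0}}{\partial\beta_i\partial\beta_j}\right]^{-1}=n_0\left[\frac{\partial^2\log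 L(\beta\mid D_0)}{\partial\beta_i\partial\beta_j}\right]^{-1}$, as functions of $\beta\in B$, do not depend on $n$. (This holds in particular if $n\left[\frac{\partial^2\log L(\beta\mid D)}{\partial\beta_i\partial\beta_j}\right]^{-1}$ and $n_0a_0\left[\frac{\partial^2\log [L(\beta\mid D_0)^{a_0}\pi_0(\beta)]}{\partial\beta_i\partial\beta_j}\right]^{-1}$ exist and depend neither on $n$ nor on $a_0\in(0,1]$: two different values of $a_0$ then show that $\partial^2\log\pi_0=0$.) Then the marginal posterior is integrable on $[0,1]$ with positive integral, and it converges to a point mass at zero: for every $\varepsilon>0$, $$\lim_{n\to\infty}\frac{\int_0^{\varepsilon}\pi(a_0\mid D,D_0,\alpha_0,\beta_0)\,da_0}{\int_0^{1}\pi(a_0\mid D,D_0,\alpha_0,\beta_0)\,da_0}=1 .$$ -/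

import Mathlib

open MeasureTheory Filter Topology Set
open scoped Matrix

noncomputable section

/-- A one-parameter exponential family in canonical form with dispersion `φ = 1`:
densities `y ↦ q y * exp (y * θ - b θ)` with respect to a reference measure `ν` on `ℝ`, for `θ` in
an open set `Θ` of canonical parameters.  The family is not a family of point masses. -/
structure ExpFamily where
  /-- the reference measure (for example counting measure or Lebesgue measure) -/
  ν : Measure ℝ
  q : ℝ → ℝ
  b : ℝ → ℝ
  Θ : Set ℝ
  measurable_q : Measurable q
  q_nonneg : ∀ y, 0 ≤ q y
  isOpen_Θ : IsOpen Θ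
  normalized : ∀ θ ∈ Θ, ∫⁻ y, ENNReal.ofReal (q y * Real.exp (y * θ - b θ)) ∂ν = 1
  nondegenerate : ∀ c : ℝ, ¬ ∀ᵐ y ∂ν, q y ≠ 0 → y = c

/-- The density `p(y | θ)`. -/
def ExpFamily.density (F : ExpFamily) (y θ : ℝ) : ℝ := F.q y * Real.exp (y * θ - F.b θ)

/-- A data set `D = (n, Y, X)`: the number of subjects, the responses, and the design matrix, whose
`i`-th row is the covariate vector `x_i` of subject `i`. -/
structure Dataset (p : ℕ) where
  n : ℕ
  Y : Fin n → ℝ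
  X : Matrix (Fin n) (Fin p) ℝ

/-- The linear predictor `x_i' β`. -/
def Dataset.predictor {p : ℕ} (D : Dataset p) (β : EuclideanSpace ℝ (Fin p)) (i : Fin D.n) : ℝ :=
  ∑ j, D.X i j * β j

/-- The data set is admissible for the family and for the parameter space `B`: every response has
positive density, and every linear predictor is a canonical parameter of the family. -/
def Dataset.Admissible {p : ℕ} (D : Dataset p) (F : ExpFamily)
    (B : Set (EuclideanSpace ℝ (Fin p))) : Prop :=
  (∀ i, 0 < F.q (D.Y i)) ∧ ∀ β ∈ B, ∀ i, D.predictor β i ∈ F.Θ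

/-- The likelihood `L(β | D)` of the generalized linear model with canonical link. -/
def likelihood {p : ℕ} (F : ExpFamily) (D : Dataset p) (β : EuclideanSpace ℝ (Fin p)) : ℝ :=
  ∏ i, F.density (D.Y i) (D.predictor β i)

/-- The normalizing function `c*(a₀) = ∫ L(β | D₀)^a₀ π₀(β) dβ` over the parameter space `B`. -/
def normConst {p : ℕ} (F : ExpFamily) (B : Set (EuclideanSpace ℝ (Fin p)))
    (π₀ : EuclideanSpace ℝ (Fin p) → ℝ) (D₀ : Dataset p) (a₀ : ℝ) : ℝ :=
  ∫ β in B, likelihood F D₀ β ^ a₀ * π₀ β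

/-- The conditional prior density `π(β | D₀, a₀)`, i.e. the power prior with its normalization. -/
def powerPrior {p : ℕ} (F : ExpFamily) (B : Set (EuclideanSpace ℝ (Fin p)))
    (π₀ : EuclideanSpace ℝ (Fin p) → ℝ) (D₀ : Dataset p) (a₀ : ℝ)
    (β : EuclideanSpace ℝ (Fin p)) : ℝ :=
  likelihood F D₀ β ^ a₀ * π₀ β / normConst F B π₀ D₀ a₀

/-- The (unnormalized) marginal posterior density of `a₀` under the normalized power prior with
`π(a₀) = beta(α₀, β₀)`:  `∫ L(β | D) π(β | D₀, a₀) π(a₀) dβ`. -/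
def marginalPosterior {p : ℕ} (F : ExpFamily) (B : Set (EuclideanSpace ℝ (Fin p)))
    (π₀ : EuclideanSpace ℝ (Fin p) → ℝ) (D D₀ : Dataset p) (α₀ β₀ : ℝ) (a₀ : ℝ) : ℝ :=
  ∫ β in B, likelihood F D β * powerPrior F B π₀ D₀ a₀ β *
    ProbabilityTheory.betaPDFReal α₀ β₀ a₀

/-- `β` is a mode of the density `f` in the parameter space `B`, in the sense of a solution of the
equation `∂_β log f(β) = 0`. -/
def SolvesModeEquation {p : ℕ} (B : Set (EuclideanSpace ℝ (Fin p)))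
    (f : EuclideanSpace ℝ (Fin p) → ℝ) (β : EuclideanSpace ℝ (Fin p)) : Prop :=
  β ∈ B ∧ HasGradientAt (fun γ => Real.log (f γ)) 0 β

/-- The Hessian matrix `∂² f / ∂β_i ∂β_j`. -/
def hessianMatrix {p : ℕ} (f : EuclideanSpace ℝ (Fin p) → ℝ) (β : EuclideanSpace ℝ (Fin p)) :
    Matrix (Fin p) (Fin p) ℝ :=
  Matrix.of fun i j =>
    iteratedFDeriv ℝ 2 f β ![EuclideanSpace.single i 1, EuclideanSpace.single j 1]

/-- The inverse Hessian matrix `[∂² log L(β | D) / ∂β_i ∂β_j]⁻¹`, multiplied by the number of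
subjects. -/
def scaledInverseHessian {p : ℕ} (F : ExpFamily) (D : Dataset p) (β : EuclideanSpace ℝ (Fin p)) :
    Matrix (Fin p) (Fin p) ℝ :=
  (D.n : ℝ) • (hessianMatrix (fun γ => Real.log (likelihood F D γ)) β)⁻¹

end

/-! The invariance of the scaled inverse Hessians freezes the shape of the log-likelihood. Fix `b`
in `B`. The Hessian of the average log-likelihood is the same for all current data sets, so on the
convex set `B` their first-order Taylor remainders at `b` are one strictly concave function `h`
(`taylorRemainder_eq`), and `log L(β | D) - log L(b | D) = n (h β + u (β - b))`, where `u` is the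
average score at `b`. The historical data give `r n (h₀ β + v (β - b₀))` in the same way. If `b` and
`b₀` are limits of the modes, then `u` and `v` tend to zero, because the prior adds only the
gradient of `log π₀`, divided by `n₀`, to the mode equation. Hence `h` and `h₀` act as rate
functions with strict maxima `0` at `b` and at `b₀ = b - δ ≠ b`.

On the exponential scale the posterior mass at power `a`, relative to `c*(a)`, has rate `sup (h + r
a h₀)`, while the normalized `c*(a)` itself has rate `sup (r a h₀) = 0`. Because the two peaks
differ, this supremum drops strictly as `a` grows (`HasStrictPeak.exists_gap`). Powers in `[ε, 1]`
are therefore exponentially negligible, uniformly, compared with powers in `[ε/4, ε/2]`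
(`HasStrictPeak.eventually_expectation_le`). The beta prior charges that window, so the posterior
mass beyond `ε` vanishes (`integral_tail_mul_le`).

The modes are only known to stay in a compact set. The comparison is therefore proved by
contradiction, along a subsequence on which they converge. -/

section ExponentialFamily

/-! ### Smoothness and strict convexity of the cumulant function. -/

open ProbabilityTheory

namespace ExpFamily

/-- The base measure `q dν` of an exponential family. -/
noncomputable def base (F : ExpFamily) : Measure ℝ :=
  F.ν.withDensity fun y => ENNReal.ofReal (F.q y)

/-- The cumulant function of an exponential family, the smooth extension of `b`. -/
noncomputable def cumulant (F : ExpFamily) : ℝ → ℝ := cgf id F.base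

/-- The interior of the natural parameter space. -/
def natParam (F : ExpFamily) : Set ℝ := interior (integrableExpSet id F.base)

variable (F : ExpFamily)

lemma lintegral_base_exp {θ : ℝ} (hθ : θ ∈ F.Θ) :
    ∫⁻ y, ENNReal.ofReal (Real.exp (θ * y)) ∂F.base = ENNReal.ofReal (Real.exp (F.b θ)) := by
  have hm : Measurable fun y => ENNReal.ofReal (F.q y) := F.measurable_q.ennreal_ofReal
  have hm2 : Measurable fun y => ENNReal.ofReal (F.q y * Real.exp (y * θ - F.b θ)) := by
    have := F.measurable_q
    fun_prop
  rw [base, lintegral_withDensity_eq_lintegral_mul _ hm (by fun_prop)]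
  have h : ∀ y, ((fun y => ENNReal.ofReal (F.q y)) * fun y => ENNReal.ofReal (Real.exp (θ * y))) y
      = ENNReal.ofReal (Real.exp (F.b θ)) *
        ENNReal.ofReal (F.q y * Real.exp (y * θ - F.b θ)) := by
    intro y
    rw [Pi.mul_apply, ← ENNReal.ofReal_mul (F.q_nonneg y), ← ENNReal.ofReal_mul (Real.exp_pos _).le]
    congr 1
    rw [mul_left_comm, ← Real.exp_add]
    ring_nf
  simp_rw [h]
  rw [lintegral_const_mul _ hm2, F.normalized θ hθ, mul_one]

lemma integrable_exp_base {θ : ℝ} (hθ : θ ∈ F.Θ) :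
    Integrable (fun y => Real.exp (θ * id y)) F.base := by
  refine ⟨by fun_prop, ?_⟩
  rw [hasFiniteIntegral_iff_ofReal (ae_of_all _ fun y => (Real.exp_pos _).le)]
  simp only [id]
  rw [F.lintegral_base_exp hθ]
  exact ENNReal.ofReal_lt_top

/-- Normalization makes `exp (b θ)` the moment generating function of the base measure. The gain is
regularity: nothing is assumed about `b`, and `Θ` need not be convex, whereas the cumulant function
is analytic and convex on the interval `natParam`. -/
lemma b_eq_cumulant {θ : ℝ} (hθ : θ ∈ F.Θ) : F.b θ = F.cumulant θ := by
  rw [cumulant, cgf, mgf, integral_eq_lintegral_of_nonneg_ae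
    (ae_of_all _ fun y => (Real.exp_pos _).le) (by fun_prop)]
  simp only [id]
  rw [F.lintegral_base_exp hθ, ENNReal.toReal_ofReal (Real.exp_pos _).le, Real.log_exp]

lemma convex_natParam : Convex ℝ F.natParam := convex_integrableExpSet.interior

lemma subset_natParam : F.Θ ⊆ F.natParam :=
  interior_maximal (fun _ hθ => F.integrable_exp_base hθ) F.isOpen_Θ

lemma analyticAt_cumulant {θ : ℝ} (hθ : θ ∈ F.natParam) : AnalyticAt ℝ F.cumulant θ :=
  analyticAt_cgf hθ

/-- The second derivative is the variance of the tilted measure. If it vanished, the tilted measure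
would sit at one point, and so would the base measure, which is absolutely continuous with respect
to it; this is the excluded degenerate case. -/
lemma deriv2_cumulant_pos {θ : ℝ} (hθ : θ ∈ F.natParam) : 0 < deriv (deriv F.cumulant) θ := by
  have hint : Integrable (fun y => Real.exp (θ * id y)) F.base :=
    interior_subset (s := integrableExpSet id F.base) hθ
  have hne : F.base ≠ 0 := by
    intro h0
    refine F.nondegenerate 0 ?_
    have h1 : ∀ᵐ y ∂F.base, y = 0 := by rw [h0]; simp
    rw [base, ae_withDensity_iff F.measurable_q.ennreal_ofReal] at h1
    filter_upwards [h1] with y hy hq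
    exact hy (by simpa using lt_of_le_of_ne (F.q_nonneg y) (Ne.symm hq))
  have hvar : Var[id; F.base.tilted (θ * id ·)] = deriv (deriv F.cumulant) θ := by
    rw [variance_tilted_mul hθ, iteratedDeriv_succ, iteratedDeriv_one]
    rfl
  rw [← hvar]
  refine lt_of_le_of_ne (variance_nonneg _ _) fun h0 => ?_
  have : NeZero F.base := ⟨hne⟩
  have := isProbabilityMeasure_tilted hint
  have h1 := ae_eq_integral_of_variance_eq_zero (memLp_tilted_mul hθ 2) h0.symm
  have h2 := (absolutelyContinuous_tilted hint).ae_le h1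
  set c := ∫ x, id x ∂F.base.tilted (θ * id ·) with hc
  refine F.nondegenerate c ?_
  have h3 : ∀ᵐ y ∂F.base, y = c := by
    filter_upwards [h2] with y hy
    exact hy
  rw [base, ae_withDensity_iff F.measurable_q.ennreal_ofReal] at h3
  filter_upwards [h3] with y hy hq
  exact hy (by simpa using lt_of_le_of_ne (F.q_nonneg y) (Ne.symm hq))

lemma strictConvexOn_cumulant : StrictConvexOn ℝ F.natParam F.cumulant := by
  refine strictConvexOn_of_deriv2_pos' F.convex_natParam
    (fun θ hθ => (F.analyticAt_cumulant hθ).continuousAt.continuousWithinAt) fun θ hθ => ?_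
  simpa using F.deriv2_cumulant_pos hθ

end ExpFamily

end ExponentialFamily

/-! ### Derivatives and concavity of the log-likelihood; rigidity from equal Hessians. -/

section GLM

variable {p : ℕ}

namespace Dataset

/-- The linear predictor of a subject, as a continuous linear functional. -/
noncomputable def predictorL (D : Dataset p) (i : Fin D.n) : EuclideanSpace ℝ (Fin p) →L[ℝ] ℝ :=
  ∑ j, D.X i j • EuclideanSpace.proj j

lemma predictorL_apply (D : Dataset p) (i : Fin D.n) (β : EuclideanSpace ℝ (Fin p)) :
    D.predictorL i β = D.predictor β i := by
  simp [predictorL, predictor]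

/-- Full column rank of the design matrix makes the parameter identifiable. -/
lemma eq_zero_of_predictorL_eq_zero (D : Dataset p) (hX : D.X.rank = p)
    {v : EuclideanSpace ℝ (Fin p)} (hv : ∀ i, D.predictorL i v = 0) : v = 0 := by
  have hker : LinearMap.ker D.X.mulVecLin = ⊥ := by
    have h1 := LinearMap.finrank_range_add_finrank_ker D.X.mulVecLin
    have h2 : Module.finrank ℝ (LinearMap.range D.X.mulVecLin) = p := hX
    rw [h2, Module.finrank_fin_fun] at h1
    exact Submodule.finrank_eq_zero.1 (by omega)
  have h3 : (v.ofLp : Fin p → ℝ) ∈ LinearMap.ker D.X.mulVecLin := by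
    rw [LinearMap.mem_ker]
    ext i
    have := hv i
    rw [predictorL_apply] at this
    simpa [Matrix.mulVec, dotProduct, predictor] using this
  rw [hker, Submodule.mem_bot] at h3
  ext i
  simpa using congrFun h3 i

/-- The logarithm of the likelihood as a smooth expression. -/
noncomputable def logLik (F : ExpFamily) (D : Dataset p) (β : EuclideanSpace ℝ (Fin p)) : ℝ :=
  ∑ i, (Real.log (F.q (D.Y i)) + (D.Y i * D.predictorL i β - F.cumulant (D.predictorL i β)))

/-- The derivative of the log-likelihood. -/
noncomputable def score (F : ExpFamily) (D : Dataset p) (β : EuclideanSpace ℝ (Fin p)) :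
    EuclideanSpace ℝ (Fin p) →L[ℝ] ℝ :=
  ∑ i, (D.Y i - deriv F.cumulant (D.predictorL i β)) • D.predictorL i

/-- The second derivative of the log-likelihood. -/
noncomputable def scoreDeriv (F : ExpFamily) (D : Dataset p) (β : EuclideanSpace ℝ (Fin p)) :
    EuclideanSpace ℝ (Fin p) →L[ℝ] EuclideanSpace ℝ (Fin p) →L[ℝ] ℝ :=
  ∑ i, (-(deriv (deriv F.cumulant) (D.predictorL i β)) • D.predictorL i).smulRight (D.predictorL i)

variable {F : ExpFamily} {B : Set (EuclideanSpace ℝ (Fin p))} {D : Dataset p}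

lemma Admissible.mem_natParam (hD : D.Admissible F B) {β : EuclideanSpace ℝ (Fin p)} (hβ : β ∈ B)
    (i : Fin D.n) : D.predictorL i β ∈ F.natParam := by
  rw [predictorL_apply]
  exact F.subset_natParam (hD.2 β hβ i)

lemma Admissible.likelihood_pos (hD : D.Admissible F B) (β : EuclideanSpace ℝ (Fin p)) :
    0 < likelihood F D β :=
  Finset.prod_pos fun i _ => mul_pos (hD.1 i) (Real.exp_pos _)

lemma Admissible.log_likelihood (hD : D.Admissible F B) {β : EuclideanSpace ℝ (Fin p)}
    (hβ : β ∈ B) : Real.log (likelihood F D β) = D.logLik F β := by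
  rw [likelihood, Real.log_prod fun i _ =>
    (show 0 < F.density _ _ from mul_pos (hD.1 i) (Real.exp_pos _)).ne']
  refine Finset.sum_congr rfl fun i _ => ?_
  rw [ExpFamily.density, Real.log_mul (hD.1 i).ne' (Real.exp_pos _).ne', Real.log_exp,
    predictorL_apply, F.b_eq_cumulant (hD.2 β hβ i)]

lemma Admissible.hasFDerivAt_logLik (hD : D.Admissible F B) {β : EuclideanSpace ℝ (Fin p)}
    (hβ : β ∈ B) : HasFDerivAt (D.logLik F) (D.score F β) β := by
  refine HasFDerivAt.fun_sum fun i _ => ?_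
  have h1 := (F.analyticAt_cumulant (hD.mem_natParam hβ i)).differentiableAt.hasDerivAt
  have h2 := h1.comp_hasFDerivAt β (D.predictorL i).hasFDerivAt
  have h3 := (((D.predictorL i).hasFDerivAt (x := β)).const_mul (D.Y i)).sub h2
  refine (h3.const_add _).congr_fderiv ?_
  ext v
  simp [sub_mul]

lemma Admissible.hasFDerivAt_score (hD : D.Admissible F B) {β : EuclideanSpace ℝ (Fin p)}
    (hβ : β ∈ B) : HasFDerivAt (D.score F) (D.scoreDeriv F β) β := by
  refine HasFDerivAt.fun_sum fun i _ => ?_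
  have h1 := (F.analyticAt_cumulant (hD.mem_natParam hβ i)).deriv.differentiableAt.hasDerivAt
  have h2 := h1.comp_hasFDerivAt β (D.predictorL i).hasFDerivAt
  have h3 := h2.const_sub (D.Y i)
  refine (h3.smul_const (D.predictorL i)).congr_fderiv ?_
  ext v
  simp

lemma scoreDeriv_apply (β u v : EuclideanSpace ℝ (Fin p)) :
    D.scoreDeriv F β u v = -∑ i, deriv (deriv F.cumulant) (D.predictorL i β) *
      (D.predictorL i u * D.predictorL i v) := by
  simp [scoreDeriv, mul_assoc]

lemma Admissible.eq_zero_of_scoreDeriv (hD : D.Admissible F B) (hX : D.X.rank = p)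
    {β v : EuclideanSpace ℝ (Fin p)} (hβ : β ∈ B) (h : D.scoreDeriv F β v v = 0) : v = 0 := by
  refine D.eq_zero_of_predictorL_eq_zero hX fun i => ?_
  rw [scoreDeriv_apply, neg_eq_zero, Finset.sum_eq_zero_iff_of_nonneg] at h
  · have := h i (Finset.mem_univ _)
    simpa [(F.deriv2_cumulant_pos (hD.mem_natParam hβ i)).ne'] using this
  · intro i _
    exact mul_nonneg (F.deriv2_cumulant_pos (hD.mem_natParam hβ i)).le (mul_self_nonneg _)

/-- Each summand is concave along its own predictor. Full rank provides a predictor that separates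
two given points, and that summand makes the inequality strict. -/
lemma Admissible.strictConcaveOn_logLik (hD : D.Admissible F B) (hX : D.X.rank = p)
    (hB : Convex ℝ B) : StrictConcaveOn ℝ B (D.logLik F) := by
  refine ⟨hB, fun x hx y hy hxy a b ha hb hab => ?_⟩
  obtain ⟨i₀, hi₀⟩ : ∃ i, D.predictorL i x ≠ D.predictorL i y := by
    by_contra! h
    refine hxy (sub_eq_zero.1 (D.eq_zero_of_predictorL_eq_zero hX fun i => ?_))
    rw [map_sub, h i, sub_self]
  simp only [logLik, smul_eq_mul, Finset.mul_sum, ← Finset.sum_add_distrib]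
  have hc := F.strictConvexOn_cumulant
  have key : ∀ i, a * (Real.log (F.q (D.Y i)) + (D.Y i * D.predictorL i x -
        F.cumulant (D.predictorL i x))) + b * (Real.log (F.q (D.Y i)) +
        (D.Y i * D.predictorL i y - F.cumulant (D.predictorL i y))) =
      Real.log (F.q (D.Y i)) + (D.Y i * D.predictorL i (a • x + b • y) -
        (a * F.cumulant (D.predictorL i x) + b * F.cumulant (D.predictorL i y))) := by
    intro i
    rw [map_add, map_smul, map_smul, smul_eq_mul, smul_eq_mul]
    linear_combination (Real.log (F.q (D.Y i))) * hab
  simp_rw [key]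
  refine Finset.sum_lt_sum (fun i _ => ?_) ⟨i₀, Finset.mem_univ _, ?_⟩
  · have := hc.convexOn.2 (hD.mem_natParam hx i) (hD.mem_natParam hy i) ha.le hb.le hab
    simp only [smul_eq_mul] at this
    rw [map_add, map_smul, map_smul, smul_eq_mul, smul_eq_mul]
    linarith
  · have := hc.2 (hD.mem_natParam hx i₀) (hD.mem_natParam hy i₀) hi₀ ha hb hab
    simp only [smul_eq_mul] at this
    rw [map_add, map_smul, map_smul, smul_eq_mul, smul_eq_mul]
    linarith

lemma Admissible.hessianMatrix_apply (hD : D.Admissible F B) (hB : IsOpen B)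
    {β : EuclideanSpace ℝ (Fin p)} (hβ : β ∈ B) (i j : Fin p) :
    hessianMatrix (fun γ => Real.log (likelihood F D γ)) β i j =
      D.scoreDeriv F β (EuclideanSpace.single i 1) (EuclideanSpace.single j 1) := by
  have h1 : (fderiv ℝ fun γ => Real.log (likelihood F D γ)) =ᶠ[𝓝 β] D.score F := by
    filter_upwards [hB.mem_nhds hβ] with γ hγ
    refine HasFDerivAt.fderiv ((hD.hasFDerivAt_logLik hγ).congr_of_eventuallyEq ?_)
    filter_upwards [hB.mem_nhds hγ] with γ' hγ' using hD.log_likelihood hγ'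
  simp only [hessianMatrix, Matrix.of_apply, iteratedFDeriv_two_apply]
  rw [h1.fderiv_eq, (hD.hasFDerivAt_score hβ).fderiv]
  rfl

lemma _root_.EuclideanSpace.bilin_apply_eq_sum
    (T : EuclideanSpace ℝ (Fin p) →L[ℝ] EuclideanSpace ℝ (Fin p) →L[ℝ] ℝ)
    (u v : EuclideanSpace ℝ (Fin p)) :
    T u v = ∑ i, ∑ j, u i * (v j * T (EuclideanSpace.single i 1) (EuclideanSpace.single j 1)) := by
  have h : ∀ w : EuclideanSpace ℝ (Fin p), w = ∑ i, w i • EuclideanSpace.single i (1 : ℝ) := by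
    intro w
    ext j
    simp [Finset.sum_apply, Pi.single_apply]
  conv_lhs => rw [h u, h v]
  simp only [map_sum, map_smul, _root_.sum_apply, _root_.smul_apply, smul_eq_mul,
    Finset.mul_sum]
  rw [Finset.sum_comm]
  exact Finset.sum_congr rfl fun i _ => Finset.sum_congr rfl fun j _ => mul_left_comm _ _ _

/-- The Hessian is negative definite. Invertibility is needed to pass from equal inverses back to
equal Hessians, since `⁻¹` sends every singular matrix to zero. -/
lemma Admissible.isUnit_hessianMatrix (hD : D.Admissible F B) (hX : D.X.rank = p) (hB : IsOpen B)
    {β : EuclideanSpace ℝ (Fin p)} (hβ : β ∈ B) :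
    IsUnit (hessianMatrix (fun γ => Real.log (likelihood F D γ)) β) := by
  rw [← Matrix.mulVec_injective_iff_isUnit, ← Matrix.coe_mulVecLin]
  refine (injective_iff_map_eq_zero _).2 fun v hv => ?_
  have h0 : WithLp.toLp 2 v = 0 := by
    refine hD.eq_zero_of_scoreDeriv hX hβ ?_
    rw [EuclideanSpace.bilin_apply_eq_sum]
    have h1 : ∀ i, ∑ j, hessianMatrix (fun γ => Real.log (likelihood F D γ)) β i j * v j = 0 :=
      fun i => by simpa [Matrix.mulVec, dotProduct] using congrFun hv i
    simp_rw [← hD.hessianMatrix_apply hB hβ, ← Finset.mul_sum]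
    refine Finset.sum_eq_zero fun i _ => ?_
    rw [show ∑ j, (WithLp.toLp 2 v : EuclideanSpace ℝ (Fin p)) j *
        hessianMatrix (fun γ => Real.log (likelihood F D γ)) β i j = 0 from
      (Finset.sum_congr rfl fun j _ => mul_comm _ _).trans (h1 i), mul_zero]
  simpa using h0

/-- Data sets with the same scaled inverse Hessian have scores that differ by a constant. -/
lemma Admissible.score_sub_eq {D' : Dataset p} (hD : D.Admissible F B) (hX : D.X.rank = p)
    (hD' : D'.Admissible F B) (hX' : D'.X.rank = p) (hn : D.n ≠ 0) (hn' : D'.n ≠ 0)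
    (hB : IsOpen B) (hBc : Convex ℝ B)
    (hP : ∀ β ∈ B, scaledInverseHessian F D β = scaledInverseHessian F D' β)
    {x y : EuclideanSpace ℝ (Fin p)} (hx : x ∈ B) (hy : y ∈ B) :
    (D.n : ℝ)⁻¹ • D.score F x - (D.n : ℝ)⁻¹ • D.score F y =
      (D'.n : ℝ)⁻¹ • D'.score F x - (D'.n : ℝ)⁻¹ • D'.score F y := by
  have hn1 : (D.n : ℝ) ≠ 0 := by exact_mod_cast hn
  have hn2 : (D'.n : ℝ) ≠ 0 := by exact_mod_cast hn'
  have hmat : ∀ β ∈ B, (D.n : ℝ)⁻¹ • hessianMatrix (fun γ => Real.log (likelihood F D γ)) β =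
      (D'.n : ℝ)⁻¹ • hessianMatrix (fun γ => Real.log (likelihood F D' γ)) β := by
    intro β hβ
    have h := congrArg (fun M => M⁻¹) (hP β hβ)
    have aux : ∀ (M : Matrix (Fin p) (Fin p) ℝ) (c : ℝ), c ≠ 0 → IsUnit M →
        (c • M⁻¹)⁻¹ = c⁻¹ • M := by
      intro M c hc hM
      have hdet := (Matrix.isUnit_iff_isUnit_det M).1 hM
      refine Matrix.inv_eq_left_inv ?_
      rw [Matrix.smul_mul, Matrix.mul_smul, Matrix.mul_nonsing_inv _ hdet, smul_smul,
        inv_mul_cancel₀ hc, one_smul]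
    simp only [scaledInverseHessian] at h
    rwa [aux _ _ hn1 (hD.isUnit_hessianMatrix hX hB hβ),
      aux _ _ hn2 (hD'.isUnit_hessianMatrix hX' hB hβ)] at h
  have hder : ∀ β ∈ B, HasFDerivAt
      (fun γ => (D.n : ℝ)⁻¹ • D.score F γ - (D'.n : ℝ)⁻¹ • D'.score F γ)
      (0 : EuclideanSpace ℝ (Fin p) →L[ℝ] EuclideanSpace ℝ (Fin p) →L[ℝ] ℝ) β := by
    intro β hβ
    have h1 := ((hD.hasFDerivAt_score hβ).const_smul ((D.n : ℝ)⁻¹)).sub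
      ((hD'.hasFDerivAt_score hβ).const_smul ((D'.n : ℝ)⁻¹))
    refine h1.congr_fderiv ?_
    ext u v
    have h2 : (D.n : ℝ)⁻¹ * D.scoreDeriv F β u v = (D'.n : ℝ)⁻¹ * D'.scoreDeriv F β u v := by
      rw [EuclideanSpace.bilin_apply_eq_sum (D.scoreDeriv F β),
        EuclideanSpace.bilin_apply_eq_sum (D'.scoreDeriv F β)]
      simp_rw [Finset.mul_sum]
      refine Finset.sum_congr rfl fun i _ => Finset.sum_congr rfl fun j _ => ?_
      have h3 := congrFun (congrFun (hmat β hβ) i) j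
      simp only [Matrix.smul_apply, hD.hessianMatrix_apply hB hβ,
        hD'.hessianMatrix_apply hB hβ, smul_eq_mul] at h3
      linear_combination (u i * v j) * h3
    simp [h2]
  -- Equal scaled Hessians make the difference of the average scores constant on the connected set
  -- `B`.
  have h4 := hB.is_const_of_fderiv_eq_zero (𝕜 := ℝ) hBc.isPreconnected
    (fun β hβ => (hder β hβ).differentiableAt.differentiableWithinAt)
    (fun β hβ => (hder β hβ).fderiv) hx hy
  exact sub_eq_sub_iff_sub_eq_sub.1 h4

/-- The average log-likelihood minus its first-order Taylor polynomial at `x₀`. -/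
noncomputable def taylorRemainder (F : ExpFamily) (D : Dataset p)
    (x₀ β : EuclideanSpace ℝ (Fin p)) : ℝ :=
  (D.n : ℝ)⁻¹ * (D.logLik F β - D.logLik F x₀ - D.score F x₀ (β - x₀))

lemma Admissible.hasFDerivAt_taylorRemainder (hD : D.Admissible F B)
    (x₀ : EuclideanSpace ℝ (Fin p)) {β : EuclideanSpace ℝ (Fin p)} (hβ : β ∈ B) :
    HasFDerivAt (D.taylorRemainder F x₀) ((D.n : ℝ)⁻¹ • D.score F β - (D.n : ℝ)⁻¹ • D.score F x₀)
      β := by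
  have h1 : HasFDerivAt (fun γ => D.score F x₀ (γ - x₀)) (D.score F x₀) β :=
    ((D.score F x₀).hasFDerivAt.comp β ((hasFDerivAt_id β).sub_const x₀)).congr_fderiv
      (by ext; simp)
  refine (((((hD.hasFDerivAt_logLik hβ).sub_const (D.logLik F x₀)).sub h1).const_mul
    ((D.n : ℝ)⁻¹))).congr_fderiv ?_
  ext v
  simp [mul_sub]

lemma taylorRemainder_self (x₀ : EuclideanSpace ℝ (Fin p)) : D.taylorRemainder F x₀ x₀ = 0 := by
  simp [taylorRemainder]

/-- A second integration of the Hessian identity: the gradients agree by `score_sub_eq`, and both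
remainders vanish at `x₀`. A single function thus serves the whole sequence of data sets. -/
lemma Admissible.taylorRemainder_eq {D' : Dataset p} (hD : D.Admissible F B) (hX : D.X.rank = p)
    (hD' : D'.Admissible F B) (hX' : D'.X.rank = p) (hn : D.n ≠ 0) (hn' : D'.n ≠ 0)
    (hB : IsOpen B) (hBc : Convex ℝ B)
    (hP : ∀ β ∈ B, scaledInverseHessian F D β = scaledInverseHessian F D' β)
    {x₀ β : EuclideanSpace ℝ (Fin p)} (hx : x₀ ∈ B) (hβ : β ∈ B) :
    D.taylorRemainder F x₀ β = D'.taylorRemainder F x₀ β := by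
  have hder : ∀ γ ∈ B, HasFDerivAt
      (fun γ => D.taylorRemainder F x₀ γ - D'.taylorRemainder F x₀ γ)
      (0 : EuclideanSpace ℝ (Fin p) →L[ℝ] ℝ) γ := by
    intro γ hγ
    refine ((hD.hasFDerivAt_taylorRemainder x₀ hγ).sub
      (hD'.hasFDerivAt_taylorRemainder x₀ hγ)).congr_fderiv ?_
    rw [hD.score_sub_eq hX hD' hX' hn hn' hB hBc hP hγ hx, sub_self]
  have h4 := hB.is_const_of_fderiv_eq_zero (𝕜 := ℝ) hBc.isPreconnected
    (fun β hβ => (hder β hβ).differentiableAt.differentiableWithinAt)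
    (fun β hβ => (hder β hβ).fderiv) hβ hx
  simpa [taylorRemainder_self, sub_eq_zero] using h4

lemma Admissible.strictConcaveOn_taylorRemainder (hD : D.Admissible F B) (hX : D.X.rank = p)
    (hn : D.n ≠ 0) (hB : Convex ℝ B) (x₀ : EuclideanSpace ℝ (Fin p)) :
    StrictConcaveOn ℝ B (D.taylorRemainder F x₀) := by
  refine ⟨hB, fun x hx y hy hxy a b ha hb hab => ?_⟩
  have h1 := (hD.strictConcaveOn_logLik hX hB).2 hx hy hxy ha hb hab
  have h2 : (0 : ℝ) < (D.n : ℝ)⁻¹ := by positivity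
  simp only [taylorRemainder, smul_eq_mul] at h1 ⊢
  have h3 : D.score F x₀ (a • x + b • y - x₀) =
      a * D.score F x₀ (x - x₀) + b * D.score F x₀ (y - x₀) := by
    simp only [map_sub, map_add, map_smul, smul_eq_mul]
    linear_combination (D.score F x₀ x₀) * hab
  rw [h3]
  have h4 := mul_lt_mul_of_pos_left h1 h2
  linear_combination h4 - ((D.n : ℝ)⁻¹ * D.logLik F x₀) * hab

lemma Admissible.continuousOn_score (hD : D.Admissible F B) : ContinuousOn (D.score F) B :=
  fun _ hβ => (hD.hasFDerivAt_score hβ).continuousAt.continuousWithinAt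

lemma Admissible.continuousOn_likelihood (hD : D.Admissible F B) :
    ContinuousOn (likelihood F D) B := by
  have h1 : ContinuousOn (fun β => Real.exp (D.logLik F β)) B := fun β hβ =>
    (hD.hasFDerivAt_logLik hβ).continuousAt.rexp.continuousWithinAt
  refine h1.congr fun β hβ => ?_
  simp only
  rw [← hD.log_likelihood hβ, Real.exp_log (hD.likelihood_pos β)]

end Dataset

end GLM

/-! ### Concave functions with a strict maximum, and the gap between weighted sums. -/

section StrictPeak

variable {E : Type*} [NormedAddCommGroup E] [NormedSpace ℝ E]

lemma HasFDerivAt.tendsto_slope_of_zero {h : E → ℝ} {c : E}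
    (hd : HasFDerivAt h (0 : E →L[ℝ] ℝ) c) (v : E) :
    Tendsto (fun t : ℝ => t⁻¹ * (h (c + t • v) - h c)) (𝓝[>] 0) (𝓝 0) := by
  have hline : HasDerivAt (fun t : ℝ => c + t • v) v 0 := by
    simpa using ((hasDerivAt_id (0 : ℝ)).smul_const v).const_add c
  have hd' : HasFDerivAt h (0 : E →L[ℝ] ℝ) (c + (0 : ℝ) • v) := by simpa using hd
  simpa using (hd'.comp_hasDerivAt (0 : ℝ) hline).tendsto_slope_zero_right

/-- A continuous concave function on `B` with maximal value `0`, attained exactly at `c`. -/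
structure HasStrictPeak (B : Set E) (h : E → ℝ) (c : E) : Prop where
  mem : c ∈ B
  concave : ConcaveOn ℝ B h
  cont : ContinuousOn h B
  zero : h c = 0
  neg : ∀ x ∈ B, x ≠ c → h x < 0

namespace HasStrictPeak

variable {B : Set E} {h h₀ : E → ℝ} {c c₀ : E}

lemma nonpos (H : HasStrictPeak B h c) {x : E} (hx : x ∈ B) : h x ≤ 0 := by
  by_cases hxc : x = c
  · rw [hxc, H.zero]
  · exact (H.neg x hx hxc).le

/-- A critical point of a strictly concave function is a strict peak. -/
lemma of_strictConcaveOn (hh : StrictConcaveOn ℝ B h) (hc : ContinuousOn h B)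
    (hcB : c ∈ B) (h0 : h c = 0) (hd : HasFDerivAt h (0 : E →L[ℝ] ℝ) c) :
    HasStrictPeak B h c := by
  have hle : ∀ x ∈ B, h x ≤ 0 := by
    intro x hx
    -- By concavity `h x` is at most every difference quotient from `c` towards `x`, and these tend
    -- to zero.
    have h2 := hd.tendsto_slope_of_zero (x - c)
    simp only [h0, sub_zero] at h2
    refine ge_of_tendsto h2 ?_
    filter_upwards [Ioo_mem_nhdsGT (zero_lt_one : (0 : ℝ) < 1)] with t ht
    have h3 := hh.concaveOn.2 hcB hx (sub_nonneg.2 ht.2.le) ht.1.le (by ring)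
    have h4 : (1 - t) • c + t • x = c + t • (x - c) := by module
    rw [h4, h0, smul_zero, zero_add, smul_eq_mul] at h3
    rwa [← div_eq_inv_mul, le_div_iff₀ ht.1, mul_comm]
  refine ⟨hcB, hh.concaveOn, hc, h0, fun x hx hxc => ?_⟩
  have h5 := hh.2 hx hcB hxc (half_pos one_pos) (half_pos one_pos) (add_halves 1)
  have h6 := hle _ (hh.1 hx hcB (half_pos one_pos).le (half_pos one_pos).le (add_halves (1 : ℝ)))
  rw [h0] at h5
  simp only [smul_eq_mul] at h5
  linarith

/-- Away from its peak, the function decays at least linearly. -/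
lemma exists_le_neg_mul_norm [FiniteDimensional ℝ E] (H : HasStrictPeak B h c) (hB : IsOpen B)
    {ρ : ℝ} (hρ : 0 < ρ) : ∃ m > 0, ∀ x ∈ B, ρ ≤ ‖x - c‖ → h x ≤ -(m * ‖x - c‖) := by
  obtain ⟨ρ₁, hρ₁, hball⟩ := Metric.nhds_basis_closedBall.mem_iff.1 (hB.mem_nhds H.mem)
  set s := min ρ ρ₁ with hs
  have hs0 : 0 < s := lt_min hρ hρ₁
  have hsub : Metric.sphere c s ⊆ B := fun x hx => hball <|
    (Metric.mem_closedBall.2 ((Metric.mem_sphere.1 hx).le.trans (min_le_right _ _)))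
  have hproper : ProperSpace E := FiniteDimensional.proper ℝ E
  obtain ⟨m, hm, hle⟩ : ∃ m > 0, ∀ y ∈ Metric.sphere c s, h y ≤ -m := by
    rcases (Metric.sphere c s).eq_empty_or_nonempty with he | hne
    · exact ⟨1, one_pos, fun y hy => by simp [he] at hy⟩
    · obtain ⟨z, hz, hmax⟩ := (isCompact_sphere c s).exists_isMaxOn hne (H.cont.mono hsub)
      refine ⟨-h z, neg_pos.2 (H.neg z (hsub hz) ?_), fun y hy => by simpa using hmax hy⟩
      rintro rfl
      simp at hz
      exact hs0.ne hz
  refine ⟨m / s, div_pos hm hs0, fun x hx hxc => ?_⟩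
  have hpos : 0 < ‖x - c‖ := hρ.trans_le hxc
  -- The segment from `c` to `x` crosses the sphere, where `h ≤ -m`; concavity carries this bound
  -- out to `x` in proportion to the distance.
  have ht0 : 0 < s / ‖x - c‖ := div_pos hs0 hpos
  have ht1 : s / ‖x - c‖ ≤ 1 := (div_le_one hpos).2 ((min_le_left _ _).trans hxc)
  have hy : (1 - s / ‖x - c‖) • c + (s / ‖x - c‖) • x ∈ Metric.sphere c s := by
    rw [mem_sphere_iff_norm, show (1 - s / ‖x - c‖) • c + (s / ‖x - c‖) • x - c =
      (s / ‖x - c‖) • (x - c) by module, norm_smul, Real.norm_of_nonneg ht0.le,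
      div_mul_cancel₀ _ hpos.ne']
  have h1 := (H.concave.2 H.mem hx (sub_nonneg.2 ht1) ht0.le (by ring)).trans (hle _ hy)
  rw [H.zero, smul_zero, zero_add, smul_eq_mul, div_mul_eq_mul_div, div_le_iff₀ hpos] at h1
  rw [div_mul_eq_mul_div, ← neg_div, le_div_iff₀ hs0]
  linarith

/-- A small linear perturbation is dominated by a small multiple of the function itself. -/
lemma exists_linear_le [FiniteDimensional ℝ E] (H : HasStrictPeak B h c) (hB : IsOpen B)
    {η : ℝ} (hη : 0 < η) :
    ∃ τ > 0, ∀ u : E →L[ℝ] ℝ, ‖u‖ ≤ τ → ∀ x ∈ B, u (x - c) ≤ η - η * h x := by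
  obtain ⟨m, hm, hle⟩ := H.exists_le_neg_mul_norm hB one_pos
  refine ⟨min η (η * m), lt_min hη (mul_pos hη hm), fun u hu x hx => ?_⟩
  have h1 : u (x - c) ≤ ‖u‖ * ‖x - c‖ := (le_abs_self _).trans (u.le_opNorm _)
  have h2 := H.nonpos hx
  rcases le_total 1 ‖x - c‖ with hx1 | hx1
  · have h3 := hle x hx hx1
    have h4 : ‖u‖ * ‖x - c‖ ≤ η * m * ‖x - c‖ := by
      gcongr
      exact hu.trans (min_le_right _ _)
    nlinarith
  · have h4 : ‖u‖ * ‖x - c‖ ≤ η * 1 := by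
      gcongr
      exact hu.trans (min_le_left _ _)
    nlinarith

/-- Increasing the weight of one of two functions with different peaks strictly lowers the
supremum of the weighted sum. -/
lemma exists_gap [FiniteDimensional ℝ E] (H : HasStrictPeak B h c) (H₀ : HasStrictPeak B h₀ c₀)
    (hB : IsOpen B) (hne : c₀ ≠ c) (hd : HasFDerivAt h₀ (0 : E →L[ℝ] ℝ) c₀) {s₁ s₂ : ℝ}
    (hs₁ : 0 < s₁) (hs : s₁ < s₂) :
    ∃ z ∈ B, ∃ γ > 0, ∀ x ∈ B, h x + s₂ * h₀ x ≤ h z + s₁ * h₀ z - γ := by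
  have hq : 0 < -h c₀ := neg_pos.2 (H.neg c₀ H₀.mem hne)
  -- Moving from `c₀` towards `c` gains at least a linear amount in `h` by concavity, while `h₀`
  -- loses only `o(t)` at its critical point. So the weighted sum exceeds its value at `c₀`.
  obtain ⟨z₁, hz₁, hlt⟩ : ∃ z ∈ B, h c₀ < h z + s₁ * h₀ z := by
    have h2 := hd.tendsto_slope_of_zero (c - c₀)
    simp only [H₀.zero, sub_zero] at h2
    have h3 := h2.eventually (lt_mem_nhds
      (show -(-h c₀ / s₁) < 0 from neg_neg_of_pos (div_pos hq hs₁)))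
    obtain ⟨t, ht, ht'⟩ := (h3.and (Ioo_mem_nhdsGT (zero_lt_one : (0 : ℝ) < 1))).exists
    have h4 : (1 - t) • c₀ + t • c = c₀ + t • (c - c₀) := by module
    refine ⟨c₀ + t • (c - c₀), ?_, ?_⟩
    · rw [← h4]
      exact H.concave.1 H₀.mem H.mem (sub_nonneg.2 ht'.2.le) ht'.1.le (by ring)
    · have h5 := H.concave.2 H₀.mem H.mem (sub_nonneg.2 ht'.2.le) ht'.1.le (by ring)
      rw [h4, H.zero, smul_zero, add_zero, smul_eq_mul] at h5
      rw [← div_eq_inv_mul, lt_div_iff₀ ht'.1] at ht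
      have h6 : s₁ * (-(-h c₀ / s₁) * t) < s₁ * h₀ (c₀ + t • (c - c₀)) :=
        mul_lt_mul_of_pos_left ht hs₁
      have h7 : s₁ * (-(-h c₀ / s₁) * t) = h c₀ * t := by field_simp
      rw [h7] at h6
      linarith
  -- Half of the excess over `h c₀`: near `c₀`, continuity keeps `h`, hence `h + s₂ h₀`, at least
  -- `κ` below the supremum. Away from `c₀` the larger weight costs at least `(s₂ - s₁) m ρ`.
  set κ := (h z₁ + s₁ * h₀ z₁ - h c₀) / 2 with hκ
  have hκ0 : 0 < κ := by rw [hκ]; linarith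
  have hcont : ContinuousAt h c₀ := H.cont.continuousAt (hB.mem_nhds H₀.mem)
  obtain ⟨ρ, hρ, hnear⟩ := Metric.eventually_nhds_iff.1
    (hcont.eventually (gt_mem_nhds (show h c₀ < h c₀ + κ by linarith)))
  obtain ⟨m, hm, hfar⟩ := H₀.exists_le_neg_mul_norm hB hρ
  set S := (fun x => h x + s₁ * h₀ x) '' B with hS
  have hbdd : BddAbove S := by
    refine ⟨0, ?_⟩
    rintro _ ⟨x, hx, rfl⟩
    have := mul_nonpos_of_nonneg_of_nonpos hs₁.le (H₀.nonpos hx)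
    have := H.nonpos hx
    simp only
    linarith
  have hle : ∀ x ∈ B, h x + s₁ * h₀ x ≤ sSup S := fun x hx => le_csSup hbdd ⟨x, hx, rfl⟩
  set γ := min κ ((s₂ - s₁) * (m * ρ)) / 2 with hγ
  have hγ0 : 0 < γ := half_pos (lt_min hκ0 (mul_pos (sub_pos.2 hs) (mul_pos hm hρ)))
  have hγ1 : 2 * γ ≤ κ := by rw [hγ]; linarith [min_le_left κ ((s₂ - s₁) * (m * ρ))]
  have hγ2 : 2 * γ ≤ (s₂ - s₁) * (m * ρ) := by
    rw [hγ]; linarith [min_le_right κ ((s₂ - s₁) * (m * ρ))]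
  -- The supremum over the open set `B` may not be attained, so half of the gap `2γ` is spent on a
  -- near-maximizer.
  obtain ⟨_, ⟨z, hz, rfl⟩, hzlt⟩ := exists_lt_of_lt_csSup (⟨_, ⟨z₁, hz₁, rfl⟩⟩ : S.Nonempty)
    (show sSup S - γ < sSup S by linarith)
  simp only at hzlt
  refine ⟨z, hz, γ, hγ0, fun x hx => ?_⟩
  rcases lt_or_ge ‖x - c₀‖ ρ with hxρ | hxρ
  · have h1 := hnear (show dist x c₀ < ρ by rwa [dist_eq_norm])
    have h2 := mul_nonpos_of_nonneg_of_nonpos (hs₁.trans hs).le (H₀.nonpos hx)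
    have h3 := hle z₁ hz₁
    linarith
  · have h1 := hfar x hx hxρ
    have h2 := hle x hx
    have h3 : m * ρ ≤ m * ‖x - c₀‖ := mul_le_mul_of_nonneg_left hxρ hm.le
    have h4 : (s₂ - s₁) * h₀ x ≤ (s₂ - s₁) * -(m * ρ) :=
      mul_le_mul_of_nonneg_left (by linarith) (sub_nonneg.2 hs.le)
    linarith

end HasStrictPeak

end StrictPeak

/-! ### Laplace-type bounds for weighted exponential integrals. -/

section Laplace

variable {E : Type*} [NormedAddCommGroup E] [MeasurableSpace E] [BorelSpace E]
  {B : Set E} {w : E → ℝ}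

/-- The contribution of a neighbourhood bounds a weighted exponential integral from below. -/
lemma exists_exp_mul_le_setIntegral (μ : Measure E) [μ.IsOpenPosMeasure]
    [IsLocallyFiniteMeasure μ] (hB : IsOpen B) (hw : ContinuousOn w B) (hwpos : ∀ x ∈ B, 0 < w x)
    {z : E} (hz : z ∈ B) {s : Set E} (hs : s ∈ 𝓝 z) :
    ∃ m > 0, ∀ (f : E → ℝ) (T : ℝ), IntegrableOn (fun x => Real.exp (f x) * w x) B μ →
      (∀ x ∈ B, x ∈ s → T ≤ f x) → Real.exp T * m ≤ ∫ x in B, Real.exp (f x) * w x ∂μ := by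
  have h1 : {x | w z / 2 < w x} ∈ 𝓝 z :=
    (hw.continuousAt (hB.mem_nhds hz)).eventually (lt_mem_nhds (half_lt_self (hwpos z hz)))
  obtain ⟨t, htz, htfin⟩ := μ.finiteAt_nhds z
  obtain ⟨u, husub, huopen, hzu⟩ := mem_nhds_iff.1
    (inter_mem (inter_mem (hB.mem_nhds hz) hs) (inter_mem h1 htz))
  have hufin : μ u ≠ ⊤ := ((measure_mono fun x hx => (husub hx).2.2).trans_lt htfin).ne
  have hupos : 0 < μ.real u :=
    ENNReal.toReal_pos (huopen.measure_pos μ ⟨z, hzu⟩).ne' hufin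
  refine ⟨w z / 2 * μ.real u, mul_pos (half_pos (hwpos z hz)) hupos, fun f T hint hT => ?_⟩
  have huB : u ⊆ B := fun x hx => (husub hx).1.1
  calc Real.exp T * (w z / 2 * μ.real u) = ∫ _ in u, Real.exp T * (w z / 2) ∂μ := by
        rw [setIntegral_const, smul_eq_mul]; ring
    _ ≤ ∫ x in u, Real.exp (f x) * w x ∂μ := by
        refine setIntegral_mono_on (integrableOn_const hufin) (hint.mono_set huB)
          huopen.measurableSet fun x hx => ?_
        have hx1 : w z / 2 < w x := (husub hx).2.1
        exact mul_le_mul (Real.exp_le_exp.2 (hT x (huB hx) (husub hx).1.2)) hx1.le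
          (half_pos (hwpos z hz)).le (Real.exp_pos _).le
    _ ≤ ∫ x in B, Real.exp (f x) * w x ∂μ := by
        refine setIntegral_mono_set hint ?_ (LE.le.eventuallyLE huB)
        filter_upwards [ae_restrict_mem hB.measurableSet] with x hx
        exact mul_nonneg (Real.exp_pos _).le (hwpos x hx).le

lemma setIntegral_exp_mul_le (μ : Measure E) (hB : IsOpen B) (hwpos : ∀ x ∈ B, 0 < w x)
    {f g : E → ℝ} {T : ℝ} (hf : IntegrableOn (fun x => Real.exp (f x) * w x) B μ)
    (hg : IntegrableOn (fun x => Real.exp (g x) * w x) B μ) (hle : ∀ x ∈ B, f x - g x ≤ T) :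
    ∫ x in B, Real.exp (f x) * w x ∂μ ≤ Real.exp T * ∫ x in B, Real.exp (g x) * w x ∂μ := by
  rw [← integral_const_mul]
  refine setIntegral_mono_on hf (hg.const_mul _) hB.measurableSet fun x hx => ?_
  rw [← mul_assoc, ← Real.exp_add]
  exact mul_le_mul_of_nonneg_right (Real.exp_le_exp.2 (by linarith [hle x hx])) (hwpos x hx).le

end Laplace

/-! ### Uniform comparison of different powers of a sharpening density. -/

section PowerWeights

variable {E : Type*} [NormedAddCommGroup E] [NormedSpace ℝ E] [FiniteDimensional ℝ E]
  {B : Set E} {h h₀ w : E → ℝ} {c c₀ : E} {n : ℕ → ℝ} {u v : ℕ → E →L[ℝ] ℝ} {r ε : ℝ}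

/-- Comparison of powers of a sequence of sharpening densities with a fixed member of it. -/
lemma HasStrictPeak.eventually_power_sub_le (H₀ : HasStrictPeak B h₀ c₀) (hB : IsOpen B)
    (hnpos : ∀ k, 0 < n k) (hn : Tendsto n atTop atTop) (hv : Tendsto v atTop (𝓝 0))
    (hr : 0 < r) (hε : 0 < ε) {η : ℝ} (hη : 0 < η) (hη1 : η ≤ 1) :
    ∀ᶠ k in atTop, ∀ a ∈ Icc ε 1, ∀ x ∈ B,
      a * (r * n k * (h₀ x + v k (x - c₀))) - r * n 0 * (h₀ x + v 0 (x - c₀)) ≤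
        n k * (r * (3 / 4 * a * ((1 - η) * h₀ x)) + r * η) := by
  obtain ⟨τ, hτ, hlin⟩ := H₀.exists_linear_le hB hη
  have e1 : ∀ᶠ k in atTop, ‖v k‖ ≤ τ / 4 := by
    have := (tendsto_zero_iff_norm_tendsto_zero.1 hv).eventually
      (gt_mem_nhds (show 0 < τ / 4 by linarith))
    exact this.mono fun k hk => hk.le
  filter_upwards [e1, hn.eventually_ge_atTop (4 * n 0 / ε),
    hn.eventually_ge_atTop (4 * (n 0 * ‖v 0‖) / (ε * τ))] with k h1 h2 h3 a ha x hx
  rw [div_le_iff₀ hε] at h2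
  rw [div_le_iff₀ (mul_pos hε hτ)] at h3
  have hnk := hnpos k
  have hn0 := hnpos 0
  have hna : n k * ε ≤ n k * a := mul_le_mul_of_nonneg_left ha.1 hnk.le
  have hna1 : n k * a ≤ n k := mul_le_of_le_one_right hnk.le ha.2
  have hna0 : 0 < n k * a := mul_pos hnk (hε.trans_le ha.1)
  -- The difference is `q` times `h₀` plus a linear term; divided by `q`, that term is small enough
  -- for `exists_linear_le`.
  set q := n k * a - n 0 with hq
  have hq1 : 3 / 4 * (n k * a) ≤ q := by linarith
  have hq0 : 0 < q := by linarith
  have hnorm : ‖q⁻¹ • ((n k * a) • v k - n 0 • v 0)‖ ≤ τ := by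
    rw [norm_smul, norm_inv, Real.norm_of_nonneg hq0.le, inv_mul_le_iff₀ hq0]
    have h4 : ‖(n k * a) • v k - n 0 • v 0‖ ≤ n k * a * ‖v k‖ + n 0 * ‖v 0‖ := by
      refine (norm_sub_le _ _).trans_eq ?_
      rw [norm_smul, norm_smul, Real.norm_of_nonneg hna0.le, Real.norm_of_nonneg hn0.le]
    have h5 : n k * a * ‖v k‖ ≤ n k * a * (τ / 4) := mul_le_mul_of_nonneg_left h1 hna0.le
    have h6 : n k * ε * τ ≤ n k * a * τ := mul_le_mul_of_nonneg_right hna hτ.le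
    have h7 : 3 / 4 * (n k * a) * τ ≤ q * τ := mul_le_mul_of_nonneg_right hq1 hτ.le
    have h8 := mul_pos hna0 hτ
    linarith
  have h4 := hlin _ hnorm x hx
  simp only [_root_.smul_apply, _root_.sub_apply, smul_eq_mul] at h4
  rw [inv_mul_le_iff₀ hq0] at h4
  have h5 := H₀.nonpos hx
  have h6 : q * ((1 - η) * h₀ x) ≤ 3 / 4 * (n k * a) * ((1 - η) * h₀ x) :=
    mul_le_mul_of_nonpos_right hq1 (mul_nonpos_of_nonneg_of_nonpos (by linarith) h5)
  have h7 : q * η ≤ n k * η := mul_le_mul_of_nonneg_right (by linarith) hη.le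
  have h8 : n k * a * (h₀ x + v k (x - c₀)) - n 0 * (h₀ x + v 0 (x - c₀)) ≤
      n k * (3 / 4 * a * ((1 - η) * h₀ x) + η) := by
    have : n k * a * (h₀ x + v k (x - c₀)) - n 0 * (h₀ x + v 0 (x - c₀)) =
      q * h₀ x + (n k * a * v k (x - c₀) - n 0 * v 0 (x - c₀)) := by rw [hq]; ring
    rw [this]
    linarith
  have h9 := mul_le_mul_of_nonneg_left h8 hr.le
  linarith

variable [MeasurableSpace E] [BorelSpace E]

/-- For two sequences of sharpening log-concave densities with different peaks, the expectation of
the first under the `a`-th power of the second is, for `a` bounded away from zero, negligible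
in comparison with its value at smaller powers. -/
theorem HasStrictPeak.eventually_expectation_le (μ : Measure E) [μ.IsOpenPosMeasure]
    [IsLocallyFiniteMeasure μ] (hB : IsOpen B) (hw : ContinuousOn w B) (hwpos : ∀ x ∈ B, 0 < w x)
    (H : HasStrictPeak B h c) (H₀ : HasStrictPeak B h₀ c₀) (hne : c₀ ≠ c)
    (hd : HasFDerivAt h₀ (0 : E →L[ℝ] ℝ) c₀) (hnpos : ∀ k, 0 < n k)
    (hn : Tendsto n atTop atTop) (hu : Tendsto u atTop (𝓝 0)) (hv : Tendsto v atTop (𝓝 0))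
    (hr : 0 < r) (hε : 0 < ε) (hε1 : ε ≤ 1) {f g : ℕ → E → ℝ}
    (hf : ∀ k, ∀ x ∈ B, f k x = n k * (h x + u k (x - c)))
    (hg : ∀ k, ∀ x ∈ B, g k x = r * n k * (h₀ x + v k (x - c₀)))
    (hgint : ∀ k, ∀ a ∈ Ioc (0 : ℝ) 1, IntegrableOn (fun x => Real.exp (a * g k x) * w x) B μ)
    (hfint : ∀ k, ∀ a ∈ Ioc (0 : ℝ) 1,
      IntegrableOn (fun x => Real.exp (f k x + a * g k x) * w x) B μ) {κ : ℝ} (hκ : 0 < κ) :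
    ∀ᶠ k in atTop, ∀ a ∈ Icc ε 1, ∀ a' ∈ Icc (ε / 4) (ε / 2),
      (∫ x in B, Real.exp (f k x + a * g k x) * w x ∂μ) *
          ∫ x in B, Real.exp (a' * g k x) * w x ∂μ ≤
        κ * ((∫ x in B, Real.exp (f k x + a' * g k x) * w x ∂μ) *
          ∫ x in B, Real.exp (a * g k x) * w x ∂μ) := by
  -- Powers `a ≥ ε` still count as at least `3ε/4` after the loss of a quarter, and `a' ≤ ε/2` stays
  -- strictly below that.
  obtain ⟨z, hz, γ, hγ, hgap⟩ := H.exists_gap H₀ hB hne hd (s₁ := r * (ε / 2))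
    (s₂ := r * (3 / 4 * ε)) (by positivity) (mul_lt_mul_of_pos_left (by linarith) hr)
  set V := h z + r * (ε / 2) * h₀ z with hV
  have hV0 : V ≤ 0 := by
    have h1 := mul_nonpos_of_nonneg_of_nonpos (show 0 ≤ r * (ε / 2) by positivity) (H₀.nonpos hz)
    have h2 := H.nonpos hz
    linarith
  have hden : 0 < γ - V + 4 + 3 * r := by linarith
  -- Chosen so that the total error in the four bounds `hN`, `hC'`, `hN'`, `hC`, namely `η (γ - V +
  -- 4 + 3r)`, uses up exactly half of the gap `γ`.
  set η := γ / (2 * (γ - V + 4 + 3 * r)) with hη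
  have hη0 : 0 < η := by positivity
  have hη1 : η ≤ 1 := by
    rw [hη, div_le_one (by positivity)]
    linarith
  have hηeq : η * (γ - V + 4 + 3 * r) = γ / 2 := by rw [hη]; field_simp
  obtain ⟨τ, hτ, hlin⟩ := H.exists_linear_le hB hη0
  have hnorm : ∀ {s : ℕ → E →L[ℝ] ℝ}, Tendsto s atTop (𝓝 0) → ∀ {t : ℝ}, 0 < t →
      ∀ᶠ k in atTop, ‖s k‖ ≤ t := fun hs t ht =>
    ((tendsto_zero_iff_norm_tendsto_zero.1 hs).eventually (gt_mem_nhds ht)).mono fun k hk => hk.le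
  have hsmall : ∀ {s : ℕ → E →L[ℝ] ℝ}, Tendsto s atTop (𝓝 0) → ∀ (y : E) {t : ℝ}, 0 < t →
      ∀ᶠ k in atTop, ∀ x ∈ Metric.ball z 1 ∪ Metric.ball c₀ 1, -t ≤ s k (x - y) := by
    intro s hs y t ht
    have hR : 0 < 1 + ‖z - y‖ + ‖c₀ - y‖ := by positivity
    filter_upwards [hnorm hs (div_pos ht hR)] with k hk x hx
    have h1 : ‖x - y‖ ≤ 1 + ‖z - y‖ + ‖c₀ - y‖ := by
      rcases hx with hx | hx
      · have h2 := norm_sub_le_norm_sub_add_norm_sub x z y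
        have h3 := mem_ball_iff_norm.1 hx
        have h4 := norm_nonneg (c₀ - y)
        linarith
      · have h2 := norm_sub_le_norm_sub_add_norm_sub x c₀ y
        have h3 := mem_ball_iff_norm.1 hx
        have h4 := norm_nonneg (z - y)
        linarith
    have h2 : ‖s k (x - y)‖ ≤ t / (1 + ‖z - y‖ + ‖c₀ - y‖) * (1 + ‖z - y‖ + ‖c₀ - y‖) :=
      ((s k).le_opNorm _).trans (mul_le_mul hk h1 (norm_nonneg _) (by positivity))
    rw [div_mul_cancel₀ _ hR.ne'] at h2
    exact (abs_le.1 h2).1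
  have hzcont := H.cont.continuousAt (hB.mem_nhds hz)
  have hzcont₀ := H₀.cont.continuousAt (hB.mem_nhds hz)
  have hccont₀ := H₀.cont.continuousAt (hB.mem_nhds H₀.mem)
  -- The masses `m₁` and `m₂` are fixed before `k`, so the factor `exp (-(γ/2) n k)` eventually
  -- beats all constants.
  obtain ⟨m₁, hm₁, hlow₁⟩ := exists_exp_mul_le_setIntegral μ hB hw hwpos hz
    (inter_mem (Metric.ball_mem_nhds z one_pos)
      ((hzcont.eventually (lt_mem_nhds (show h z - η < h z by linarith))).and
        ((hzcont₀.const_mul (r * (ε / 2))).eventually (lt_mem_nhds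
          (show r * (ε / 2) * h₀ z - η < r * (ε / 2) * h₀ z by linarith)))))
  obtain ⟨m₂, hm₂, hlow₂⟩ := exists_exp_mul_le_setIntegral μ hB hw hwpos H₀.mem
    (inter_mem (Metric.ball_mem_nhds c₀ one_pos)
      (hccont₀.eventually (lt_mem_nhds (show h₀ c₀ - η / 2 < h₀ c₀ by linarith))))
  set M := ∫ x in B, Real.exp (1 * g 0 x) * w x ∂μ with hM
  have hM0 : 0 ≤ M := setIntegral_nonneg hB.measurableSet fun x hx =>
    mul_nonneg (Real.exp_pos _).le (hwpos x hx).le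
  have hdecay : ∀ᶠ k in atTop, Real.exp (-(γ / 2) * n k) * (M * M) < κ * (m₁ * m₂) := by
    have h1 : Tendsto (fun k => Real.exp (-(γ / 2) * n k) * (M * M)) atTop (𝓝 (0 * (M * M))) :=
      (Real.tendsto_exp_atBot.comp
        (hn.const_mul_atTop_of_neg (neg_neg_of_pos (half_pos hγ)))).mul_const _
    rw [zero_mul] at h1
    exact h1.eventually (gt_mem_nhds (by positivity))
  filter_upwards [hdecay, H₀.eventually_power_sub_le hB hnpos hn hv hr
    (show 0 < ε / 4 by linarith) hη0 hη1, hnorm hu hτ, hsmall hu c (half_pos hη0),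
    hsmall hv c₀ (half_pos hη0), hsmall hv c₀ (show 0 < η / 2 / r by positivity)]
    with k hk hpow huk husmall hvsmall hvsmall' a ha a' ha'
  have hnk := hnpos k
  have ha0 : a ∈ Ioc (0 : ℝ) 1 := ⟨hε.trans_le ha.1, ha.2⟩
  have ha'0 : a' ∈ Ioc (0 : ℝ) 1 := ⟨by linarith [ha'.1], by linarith [ha'.2]⟩
  have hN : ∫ x in B, Real.exp (f k x + a * g k x) * w x ∂μ ≤
      Real.exp (n k * ((1 - η) * (V - γ) + (1 + r) * η)) * M := by
    refine setIntegral_exp_mul_le μ hB hwpos (hfint k a ha0) (hgint 0 1 (by simp)) fun x hx => ?_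
    have h1 := hpow a ⟨by linarith [ha.1], ha.2⟩ x hx
    have h2 := hlin _ huk x hx
    have h3 : (1 - η) * (h x + r * (3 / 4 * a) * h₀ x) ≤ (1 - η) * (V - γ) := by
      refine mul_le_mul_of_nonneg_left ((add_le_add_right ?_ _).trans (hgap x hx)) (by linarith)
      exact mul_le_mul_of_nonpos_right (by have := ha.1; gcongr) (H₀.nonpos hx)
    rw [hf k x hx, hg k x hx, hg 0 x hx]
    have h4 : n k * (h x + u k (x - c)) ≤ n k * (h x + (η - η * h x)) := by gcongr
    have h5 := mul_le_mul_of_nonneg_left h3 hnk.le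
    linarith
  have hC' : ∫ x in B, Real.exp (a' * g k x) * w x ∂μ ≤ Real.exp (n k * (r * η)) * M := by
    refine setIntegral_exp_mul_le μ hB hwpos (hgint k a' ha'0) (hgint 0 1 (by simp))
      fun x hx => ?_
    have h1 := hpow a' ⟨ha'.1, ha'0.2⟩ x hx
    rw [hg k x hx, hg 0 x hx]
    have h2 : r * (3 / 4 * a' * ((1 - η) * h₀ x)) ≤ 0 := by
      refine mul_nonpos_of_nonneg_of_nonpos hr.le (mul_nonpos_of_nonneg_of_nonpos ?_
        (mul_nonpos_of_nonneg_of_nonpos (by linarith) (H₀.nonpos hx)))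
      linarith [ha'0.1]
    have h3 := mul_nonpos_of_nonneg_of_nonpos hnk.le h2
    linarith
  have hN' : Real.exp (n k * (V - 3 * η)) * m₁ ≤
      ∫ x in B, Real.exp (f k x + a' * g k x) * w x ∂μ := by
    refine hlow₁ _ _ (hfint k a' ha'0) fun x hx hxs => ?_
    rw [hf k x hx, hg k x hx]
    have h1 := husmall x (Or.inl hxs.1)
    have h2 := hvsmall' x (Or.inl hxs.1)
    have h3 : h z - η < h x := hxs.2.1
    have h4 : r * (ε / 2) * h₀ z - η < r * (ε / 2) * h₀ x := hxs.2.2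
    have h5 : r * (ε / 2) * h₀ x ≤ r * a' * h₀ x :=
      mul_le_mul_of_nonpos_right (by have := ha'.2; gcongr) (H₀.nonpos hx)
    have h6 : -(η / 2) ≤ r * a' * v k (x - c₀) := by
      have h7 : r * a' * -(η / 2 / r) ≤ r * a' * v k (x - c₀) :=
        mul_le_mul_of_nonneg_left h2 (mul_nonneg hr.le ha'0.1.le)
      have h8 : r * a' * -(η / 2 / r) = -(η / 2) * a' := by field_simp
      nlinarith [ha'0.2]
    have h7 : V - 3 * η ≤ h x + u k (x - c) + r * a' * (h₀ x + v k (x - c₀)) := by linarith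
    have h8 := mul_le_mul_of_nonneg_left h7 hnk.le
    linarith
  have hC : Real.exp (n k * (-(r * η))) * m₂ ≤ ∫ x in B, Real.exp (a * g k x) * w x ∂μ := by
    refine hlow₂ _ _ (hgint k a ha0) fun x hx hxs => ?_
    rw [hg k x hx]
    have h1 := hvsmall x (Or.inr hxs.1)
    have h2 : h₀ c₀ - η / 2 < h₀ x := hxs.2
    rw [H₀.zero] at h2
    have h3 : -η ≤ a * (h₀ x + v k (x - c₀)) := by nlinarith [ha0.1, ha0.2]
    have h4 := mul_le_mul_of_nonneg_left h3 (mul_nonneg hr.le hnk.le)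
    linarith
  have hC'0 : 0 ≤ ∫ x in B, Real.exp (a' * g k x) * w x ∂μ :=
    setIntegral_nonneg hB.measurableSet fun x hx =>
      mul_nonneg (Real.exp_pos _).le (hwpos x hx).le
  calc _ ≤ Real.exp (n k * ((1 - η) * (V - γ) + (1 + r) * η)) * M *
        (Real.exp (n k * (r * η)) * M) := mul_le_mul hN hC' hC'0 (by positivity)
    _ = Real.exp (n k * (V - 3 * η)) * Real.exp (n k * (-(r * η))) *
        (Real.exp (-(γ / 2) * n k) * (M * M)) := by
      rw [mul_mul_mul_comm, ← Real.exp_add, ← Real.exp_add, ← mul_assoc (Real.exp _) (Real.exp _),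
        ← Real.exp_add]
      congr 2
      linear_combination (n k) * hηeq
    _ ≤ Real.exp (n k * (V - 3 * η)) * Real.exp (n k * (-(r * η))) * (κ * (m₁ * m₂)) :=
      mul_le_mul_of_nonneg_left hk.le (by positivity)
    _ = κ * (Real.exp (n k * (V - 3 * η)) * m₁ * (Real.exp (n k * (-(r * η))) * m₂)) := by ring
    _ ≤ _ := by
      refine mul_le_mul_of_nonneg_left (mul_le_mul hN' hC (by positivity) ?_) hκ.le
      exact le_trans (by positivity) hN'

end PowerWeights

/-! ### Integrability and positivity of the marginal posterior. -/

section MarginalPosterior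

lemma setIntegral_pos_of_pos {E : Type*} [TopologicalSpace E] [MeasurableSpace E] [BorelSpace E]
    {μ : Measure E} [μ.IsOpenPosMeasure] {B : Set E} (hB : IsOpen B) (hne : B.Nonempty) {f : E → ℝ}
    (hf : IntegrableOn f B μ) (hpos : ∀ x ∈ B, 0 < f x) : 0 < ∫ x in B, f x ∂μ := by
  rw [setIntegral_pos_iff_support_of_nonneg_ae _ hf]
  · have h1 : B ⊆ Function.support f ∩ B := fun x hx => ⟨(hpos x hx).ne', hx⟩
    exact (hB.measure_pos μ hne).trans_le (measure_mono h1)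
  · filter_upwards [ae_restrict_mem hB.measurableSet] with x hx using (hpos x hx).le

/-- Integrate the pointwise comparison against `d a` and `d a'`, then enlarge the window `[ε/4,
ε/2]` to `[0, 1]`. -/
lemma integral_tail_mul_le {Z d : ℝ → ℝ} {ε κ : ℝ} (hε : 0 < ε) (hε1 : ε ≤ 1) (hκ : 0 ≤ κ)
    (hd : ∀ a, 0 ≤ d a) (hdint : IntervalIntegrable d volume 0 1)
    (hint : IntervalIntegrable (fun a => Z a * d a) volume 0 1)
    (hnonneg : ∀ a ∈ Ioc (0 : ℝ) 1, 0 ≤ Z a * d a)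
    (h : ∀ a ∈ Icc ε 1, ∀ a' ∈ Icc (ε / 4) (ε / 2), Z a ≤ κ * Z a') :
    (∫ a in ε..1, Z a * d a) * (∫ a in (ε / 4)..(ε / 2), d a) ≤
      κ * (∫ a in ε..1, d a) * ∫ a in (0 : ℝ)..1, Z a * d a := by
  have hsub : ∀ {s t : ℝ}, 0 ≤ s → s ≤ t → t ≤ 1 → uIcc s t ⊆ uIcc 0 1 := fun hs hst ht => by
    rw [uIcc_of_le hst, uIcc_of_le zero_le_one]
    exact Icc_subset_Icc hs ht
  have s1 := hsub hε.le hε1 le_rfl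
  have s2 := hsub (show 0 ≤ ε / 4 by linarith) (show ε / 4 ≤ ε / 2 by linarith)
    (show ε / 2 ≤ 1 by linarith)
  have hW : 0 ≤ ∫ a in ε..1, d a := intervalIntegral.integral_nonneg hε1 fun a _ => hd a
  have h1 : ∀ a' ∈ Icc (ε / 4) (ε / 2), ∫ a in ε..1, Z a * d a ≤ κ * Z a' * ∫ a in ε..1, d a := by
    intro a' ha'
    rw [← intervalIntegral.integral_const_mul]
    exact intervalIntegral.integral_mono_on hε1 (hint.mono_set s1)
      ((hdint.mono_set s1).const_mul _) fun a ha => mul_le_mul_of_nonneg_right (h a ha a' ha') (hd a)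
  calc (∫ a in ε..1, Z a * d a) * (∫ a in (ε / 4)..(ε / 2), d a)
      = ∫ a' in (ε / 4)..(ε / 2), (∫ a in ε..1, Z a * d a) * d a' :=
        (intervalIntegral.integral_const_mul _ _).symm
    _ ≤ ∫ a' in (ε / 4)..(ε / 2), κ * (∫ a in ε..1, d a) * (Z a' * d a') := by
        refine intervalIntegral.integral_mono_on (by linarith) ((hdint.mono_set s2).const_mul _)
          ((hint.mono_set s2).const_mul _) fun a' ha' => ?_
        have h2 := mul_le_mul_of_nonneg_right (h1 a' ha') (hd a')
        linarith
    _ = κ * (∫ a in ε..1, d a) * ∫ a' in (ε / 4)..(ε / 2), Z a' * d a' :=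
        intervalIntegral.integral_const_mul _ _
    _ ≤ κ * (∫ a in ε..1, d a) * ∫ a in (0 : ℝ)..1, Z a * d a := by
        refine mul_le_mul_of_nonneg_left ?_ (mul_nonneg hκ hW)
        refine intervalIntegral.integral_mono_interval (by linarith) (by linarith) (by linarith) ?_
          hint
        filter_upwards [ae_restrict_mem measurableSet_Ioc] with a ha using hnonneg a ha

namespace ProbabilityTheory

lemma betaPDFReal_nonneg' {α β : ℝ} (hα : 0 < α) (hβ : 0 < β) (a : ℝ) : 0 ≤ betaPDFReal α β a := by
  by_cases h : 0 < a ∧ a < 1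
  · exact (betaPDFReal_pos h.1 h.2 hα hβ).le
  · rw [betaPDFReal, if_neg h]

lemma integrable_betaPDFReal {α β : ℝ} (hα : 0 < α) (hβ : 0 < β) :
    Integrable (betaPDFReal α β) := by
  refine (lintegral_ofReal_ne_top_iff_integrable
    (stronglyMeasurable_betaPDFReal α β).aestronglyMeasurable
    (ae_of_all _ (betaPDFReal_nonneg' hα hβ))).1 ?_
  have h := lintegral_betaPDF_eq_one hα hβ
  simp only [betaPDF] at h
  rw [h]
  exact ENNReal.one_ne_top

end ProbabilityTheory

open ProbabilityTheory

variable {p : ℕ} {F : ExpFamily} {B : Set (EuclideanSpace ℝ (Fin p))}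
  {π₀ : EuclideanSpace ℝ (Fin p) → ℝ} {D D₀ : Dataset p}

/-- The unnormalized posterior mass, as a function of the power `a₀`. -/
noncomputable def jointMass (F : ExpFamily) (B : Set (EuclideanSpace ℝ (Fin p)))
    (π₀ : EuclideanSpace ℝ (Fin p) → ℝ) (D D₀ : Dataset p) (a₀ : ℝ) : ℝ :=
  ∫ β in B, likelihood F D β * (likelihood F D₀ β ^ a₀ * π₀ β)

lemma marginalPosterior_eq (α₀ β₀ a₀ : ℝ) : marginalPosterior F B π₀ D D₀ α₀ β₀ a₀ =
    jointMass F B π₀ D D₀ a₀ / normConst F B π₀ D₀ a₀ * betaPDFReal α₀ β₀ a₀ := by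
  rw [marginalPosterior, jointMass, integral_mul_const, ← integral_div]
  congr 2
  ext β
  rw [powerPrior]
  ring

lemma Dataset.Admissible.hasStrictPeak_taylorRemainder {D : Dataset p} (hD : D.Admissible F B)
    (hX : D.X.rank = p) (hn : D.n ≠ 0) (hBc : Convex ℝ B)
    {b : EuclideanSpace ℝ (Fin p)} (hb : b ∈ B) : HasStrictPeak B (D.taylorRemainder F b) b :=
  .of_strictConcaveOn (hD.strictConcaveOn_taylorRemainder hX hn hBc b)
    (fun _ hγ => (hD.hasFDerivAt_taylorRemainder b hγ).continuousAt.continuousWithinAt) hb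
    (taylorRemainder_self b) ((hD.hasFDerivAt_taylorRemainder b hb).congr_fderiv (sub_self _))

/-- The likelihood is bounded by its value at a solution of the likelihood equation. -/
lemma Dataset.Admissible.likelihood_le (hD : D.Admissible F B) (hX : D.X.rank = p) (hn : D.n ≠ 0)
    (hBc : Convex ℝ B) {b : EuclideanSpace ℝ (Fin p)} (hb : b ∈ B) (hs : D.score F b = 0)
    {β : EuclideanSpace ℝ (Fin p)} (hβ : β ∈ B) : likelihood F D β ≤ likelihood F D b := by
  have h1 := (hD.hasStrictPeak_taylorRemainder hX hn hBc hb).nonpos hβ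
  have h2 : (0 : ℝ) < (D.n : ℝ)⁻¹ := by positivity
  rw [Dataset.taylorRemainder, hs] at h1
  have h3 := nonpos_of_mul_nonpos_right h1 h2
  simp only [_root_.zero_apply, sub_zero, sub_nonpos] at h3
  rw [← hD.log_likelihood hβ, ← hD.log_likelihood hb] at h3
  exact (Real.log_le_log_iff (hD.likelihood_pos β) (hD.likelihood_pos b)).1 h3

lemma Dataset.Admissible.score_eq_zero (hD : D.Admissible F B) (hB : IsOpen B)
    {b : EuclideanSpace ℝ (Fin p)} (hb : SolvesModeEquation B (likelihood F D) b) :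
    D.score F b = 0 := by
  have h1 := hb.2.hasFDerivAt
  rw [map_zero] at h1
  refine HasFDerivAt.unique (hD.hasFDerivAt_logLik hb.1) (h1.congr_of_eventuallyEq ?_)
  filter_upwards [hB.mem_nhds hb.1] with γ hγ using (hD.log_likelihood hγ).symm

lemma Dataset.Admissible.normConst_pos (hD₀ : D₀.Admissible F B) (hB : IsOpen B)
    (hne : B.Nonempty) (hπ : ∀ β ∈ B, 0 < π₀ β) {a : ℝ}
    (hc : IntegrableOn (fun β => likelihood F D₀ β ^ a * π₀ β) B) :
    0 < normConst F B π₀ D₀ a :=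
  setIntegral_pos_of_pos hB hne hc fun β hβ =>
    mul_pos (Real.rpow_pos_of_pos (hD₀.likelihood_pos β) a) (hπ β hβ)

/-- The normalizing constant drops out of the gradient. The right-hand side depends on the data only
through the mode, so it stays bounded near a limiting mode and disappears after division by `n₀`. -/
lemma Dataset.Admissible.score_eq_neg (hD₀ : D₀.Admissible F B) (hB : IsOpen B)
    (hπ : ∀ β ∈ B, 0 < π₀ β) (hπs : ContDiffOn ℝ 1 π₀ B)
    (hc : IntegrableOn (fun β => likelihood F D₀ β ^ (1 : ℝ) * π₀ β) B)
    {b : EuclideanSpace ℝ (Fin p)} (hb : SolvesModeEquation B (powerPrior F B π₀ D₀ 1) b) :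
    D₀.score F b = -fderiv ℝ (fun β => Real.log (π₀ β)) b := by
  have hpos := hD₀.normConst_pos hB ⟨b, hb.1⟩ hπ hc
  have h1 := hb.2.hasFDerivAt
  rw [map_zero] at h1
  have hlog : DifferentiableAt ℝ (fun β => Real.log (π₀ β)) b :=
    ((hπs.log fun x hx => (hπ x hx).ne').differentiableOn one_ne_zero).differentiableAt
      (hB.mem_nhds hb.1)
  have h2 := ((hD₀.hasFDerivAt_logLik hb.1).add hlog.hasFDerivAt).sub_const
    (Real.log (normConst F B π₀ D₀ 1))
  refine eq_neg_of_add_eq_zero_left (HasFDerivAt.unique h2 (h1.congr_of_eventuallyEq ?_))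
  filter_upwards [hB.mem_nhds hb.1] with γ hγ
  have hl := hD₀.likelihood_pos γ
  rw [powerPrior, Real.rpow_one, Real.log_div (mul_pos hl (hπ γ hγ)).ne' hpos.ne',
    Real.log_mul hl.ne' (hπ γ hγ).ne', hD₀.log_likelihood hγ]
  rfl

lemma Dataset.Admissible.integrableOn_joint (hD : D.Admissible F B) (hX : D.X.rank = p)
    (hn : D.n ≠ 0) (hB : IsOpen B) (hBc : Convex ℝ B) {b : EuclideanSpace ℝ (Fin p)}
    (hb : SolvesModeEquation B (likelihood F D) b) {a : ℝ}
    (hc : IntegrableOn (fun β => likelihood F D₀ β ^ a * π₀ β) B) :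
    IntegrableOn (fun β => likelihood F D β * (likelihood F D₀ β ^ a * π₀ β)) B := by
  refine Integrable.bdd_mul (c := likelihood F D b) hc
    (hD.continuousOn_likelihood.aestronglyMeasurable hB.measurableSet) ?_
  filter_upwards [ae_restrict_mem hB.measurableSet] with β hβ
  rw [Real.norm_of_nonneg (hD.likelihood_pos β).le]
  exact hD.likelihood_le hX hn hBc hb.1 (hD.score_eq_zero hB hb) hβ

lemma Dataset.Admissible.jointMass_pos (hD : D.Admissible F B) (hD₀ : D₀.Admissible F B)
    (hX : D.X.rank = p) (hn : D.n ≠ 0) (hB : IsOpen B) (hBc : Convex ℝ B)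
    (hπ : ∀ β ∈ B, 0 < π₀ β) {b : EuclideanSpace ℝ (Fin p)}
    (hb : SolvesModeEquation B (likelihood F D) b) {a : ℝ}
    (hc : IntegrableOn (fun β => likelihood F D₀ β ^ a * π₀ β) B) :
    0 < jointMass F B π₀ D D₀ a :=
  setIntegral_pos_of_pos hB ⟨b, hb.1⟩ (hD.integrableOn_joint hX hn hB hBc hb hc) fun β hβ =>
    mul_pos (hD.likelihood_pos β)
      (mul_pos (Real.rpow_pos_of_pos (hD₀.likelihood_pos β) a) (hπ β hβ))

/-- Bounds the marginal posterior by a constant multiple of the beta density, which gives its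
integrability up to the endpoint `0`. -/
lemma Dataset.Admissible.jointMass_le (hD : D.Admissible F B) (hD₀ : D₀.Admissible F B)
    (hX : D.X.rank = p) (hn : D.n ≠ 0) (hB : IsOpen B) (hBc : Convex ℝ B)
    (hπ : ∀ β ∈ B, 0 < π₀ β) {b : EuclideanSpace ℝ (Fin p)}
    (hb : SolvesModeEquation B (likelihood F D) b) {a : ℝ}
    (hc : IntegrableOn (fun β => likelihood F D₀ β ^ a * π₀ β) B) :
    jointMass F B π₀ D D₀ a ≤ likelihood F D b * normConst F B π₀ D₀ a := by
  rw [jointMass, normConst, ← integral_const_mul]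
  refine setIntegral_mono_on (hD.integrableOn_joint hX hn hB hBc hb hc) (hc.const_mul _)
    hB.measurableSet fun β hβ => ?_
  exact mul_le_mul_of_nonneg_right (hD.likelihood_le hX hn hBc hb.1 (hD.score_eq_zero hB hb) hβ)
    (mul_pos (Real.rpow_pos_of_pos (hD₀.likelihood_pos β) a) (hπ β hβ)).le

lemma Dataset.Admissible.aestronglyMeasurable_normConst (hD₀ : D₀.Admissible F B) (hB : IsOpen B)
    (hπ : ContinuousOn π₀ B) : AEStronglyMeasurable (normConst F B π₀ D₀) volume := by
  have h1 : ContinuousOn (fun z : ℝ × EuclideanSpace ℝ (Fin p) =>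
      likelihood F D₀ z.2 ^ z.1 * π₀ z.2) (univ ×ˢ B) := by
    refine ContinuousOn.mul (ContinuousOn.rpow ?_ continuousOn_fst fun z _ =>
      Or.inl (hD₀.likelihood_pos z.2).ne') (hπ.comp continuousOn_snd fun z hz => hz.2)
    exact hD₀.continuousOn_likelihood.comp continuousOn_snd fun z hz => hz.2
  have h2 := h1.aestronglyMeasurable (μ := volume.prod volume)
    (MeasurableSet.univ.prod hB.measurableSet)
  rw [← Measure.prod_restrict, Measure.restrict_univ] at h2
  exact h2.integral_prod_right'

lemma Dataset.Admissible.aestronglyMeasurable_jointMass (hD : D.Admissible F B)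
    (hD₀ : D₀.Admissible F B) (hB : IsOpen B) (hπ : ContinuousOn π₀ B) :
    AEStronglyMeasurable (jointMass F B π₀ D D₀) volume := by
  have h1 : ContinuousOn (fun z : ℝ × EuclideanSpace ℝ (Fin p) =>
      likelihood F D z.2 * (likelihood F D₀ z.2 ^ z.1 * π₀ z.2)) (univ ×ˢ B) := by
    refine ContinuousOn.mul (hD.continuousOn_likelihood.comp continuousOn_snd fun z hz => hz.2)
      (ContinuousOn.mul (ContinuousOn.rpow ?_ continuousOn_fst fun z _ =>
        Or.inl (hD₀.likelihood_pos z.2).ne') (hπ.comp continuousOn_snd fun z hz => hz.2))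
    exact hD₀.continuousOn_likelihood.comp continuousOn_snd fun z hz => hz.2
  have h2 := h1.aestronglyMeasurable (μ := volume.prod volume)
    (MeasurableSet.univ.prod hB.measurableSet)
  rw [← Measure.prod_restrict, Measure.restrict_univ] at h2
  exact h2.integral_prod_right'

lemma Dataset.Admissible.intervalIntegrable_marginalPosterior (hD : D.Admissible F B)
    (hD₀ : D₀.Admissible F B) (hX : D.X.rank = p) (hn : D.n ≠ 0) (hB : IsOpen B)
    (hBc : Convex ℝ B) (hπ : ∀ β ∈ B, 0 < π₀ β) (hπc : ContinuousOn π₀ B)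
    {b : EuclideanSpace ℝ (Fin p)} (hb : SolvesModeEquation B (likelihood F D) b)
    (hc : ∀ a ∈ Ioc (0 : ℝ) 1, IntegrableOn (fun β => likelihood F D₀ β ^ a * π₀ β) B)
    {α₀ β₀ : ℝ} (hα₀ : 0 < α₀) (hβ₀ : 0 < β₀) :
    IntervalIntegrable (marginalPosterior F B π₀ D D₀ α₀ β₀) volume 0 1 := by
  rw [intervalIntegrable_iff_integrableOn_Ioc_of_le zero_le_one]
  have h1 : marginalPosterior F B π₀ D D₀ α₀ β₀ = fun a =>
      jointMass F B π₀ D D₀ a / normConst F B π₀ D₀ a * betaPDFReal α₀ β₀ a :=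
    funext fun a => marginalPosterior_eq α₀ β₀ a
  rw [h1]
  refine Integrable.bdd_mul (c := likelihood F D b)
    (integrable_betaPDFReal hα₀ hβ₀).integrableOn
    (((hD.aestronglyMeasurable_jointMass hD₀ hB hπc).aemeasurable.div
      (hD₀.aestronglyMeasurable_normConst hB hπc).aemeasurable).aestronglyMeasurable.restrict) ?_
  filter_upwards [ae_restrict_mem measurableSet_Ioc] with a ha
  have h2 := hD₀.normConst_pos hB ⟨b, hb.1⟩ hπ (hc a ha)
  rw [Real.norm_of_nonneg (div_pos
    (hD.jointMass_pos hD₀ hX hn hB hBc hπ hb (hc a ha)) h2).le, div_le_iff₀ h2]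
  exact hD.jointMass_le hD₀ hX hn hB hBc hπ hb (hc a ha)

lemma Dataset.Admissible.integral_marginalPosterior_pos (hD : D.Admissible F B)
    (hD₀ : D₀.Admissible F B) (hX : D.X.rank = p) (hn : D.n ≠ 0) (hB : IsOpen B)
    (hBc : Convex ℝ B) (hπ : ∀ β ∈ B, 0 < π₀ β) (hπc : ContinuousOn π₀ B)
    {b : EuclideanSpace ℝ (Fin p)} (hb : SolvesModeEquation B (likelihood F D) b)
    (hc : ∀ a ∈ Ioc (0 : ℝ) 1, IntegrableOn (fun β => likelihood F D₀ β ^ a * π₀ β) B)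
    {α₀ β₀ : ℝ} (hα₀ : 0 < α₀) (hβ₀ : 0 < β₀) :
    0 < ∫ a in (0 : ℝ)..1, marginalPosterior F B π₀ D D₀ α₀ β₀ a := by
  refine intervalIntegral.intervalIntegral_pos_of_pos_on
    (hD.intervalIntegrable_marginalPosterior hD₀ hX hn hB hBc hπ hπc hb hc hα₀ hβ₀)
    (fun a ha => ?_) one_pos
  have ha' : a ∈ Ioc (0 : ℝ) 1 := ⟨ha.1, ha.2.le⟩
  rw [marginalPosterior_eq]
  exact mul_pos (div_pos (hD.jointMass_pos hD₀ hX hn hB hBc hπ hb (hc a ha'))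
    (hD₀.normConst_pos hB ⟨b, hb.1⟩ hπ (hc a ha'))) (betaPDFReal_pos ha.1 ha.2 hα₀ hβ₀)

end MarginalPosterior

/-! ### From convergent modes to negligible posterior mass at large powers. -/

section Concentration

variable {p : ℕ} {F : ExpFamily} {B : Set (EuclideanSpace ℝ (Fin p))}
  {π₀ : EuclideanSpace ℝ (Fin p) → ℝ}

/-- The change of the average score between `x k` and `b` is the same for all data sets in the
sequence, so it is read off from the fixed data set `D 0`, whose score is continuous. -/
lemma Dataset.tendsto_score_of_tendsto {D : ℕ → Dataset p} (hD : ∀ k, (D k).Admissible F B)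
    (hX : ∀ k, (D k).X.rank = p) (hn : ∀ k, (D k).n ≠ 0) (hB : IsOpen B) (hBc : Convex ℝ B)
    (hP : ∀ k, ∀ β ∈ B, scaledInverseHessian F (D k) β = scaledInverseHessian F (D 0) β)
    {x : ℕ → EuclideanSpace ℝ (Fin p)} {b : EuclideanSpace ℝ (Fin p)} (hb : b ∈ B)
    (hx : Tendsto x atTop (𝓝 b))
    (hs : Tendsto (fun k => ((D k).n : ℝ)⁻¹ • (D k).score F (x k)) atTop (𝓝 0)) :
    Tendsto (fun k => ((D k).n : ℝ)⁻¹ • (D k).score F b) atTop (𝓝 0) := by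
  have hcont : ContinuousAt ((D 0).score F) b :=
    (hD 0).continuousOn_score.continuousAt (hB.mem_nhds hb)
  have h1 : Tendsto (fun k => ((D 0).n : ℝ)⁻¹ • (D 0).score F (x k)) atTop
      (𝓝 (((D 0).n : ℝ)⁻¹ • (D 0).score F b)) := (hcont.tendsto.comp hx).const_smul _
  have h2 := (h1.const_sub (((D 0).n : ℝ)⁻¹ • (D 0).score F b)).add hs
  rw [sub_self, add_zero] at h2
  refine h2.congr' ?_
  filter_upwards [hx.eventually (hB.mem_nhds hb)] with k hk
  rw [← (hD k).score_sub_eq (hX k) (hD 0) (hX 0) (hn k) (hn 0) hB hBc (hP k) hb hk, sub_add_cancel]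

lemma Dataset.logLik_sub_eq {D : Dataset p} (hn : D.n ≠ 0) (b β : EuclideanSpace ℝ (Fin p)) :
    D.logLik F β - D.logLik F b =
      (D.n : ℝ) * (D.taylorRemainder F b β + ((D.n : ℝ)⁻¹ • D.score F b) (β - b)) := by
  have : (D.n : ℝ) ≠ 0 := by exact_mod_cast hn
  rw [taylorRemainder, _root_.smul_apply, smul_eq_mul]
  field_simp
  ring

/-- When the modes of the two likelihoods converge to different limits, the normalized joint mass
at powers bounded away from zero becomes negligible in comparison with smaller powers. -/
theorem eventually_jointMass_le {D D₀ : ℕ → Dataset p} (hB : IsOpen B) (hBc : Convex ℝ B)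
    (hπ : ∀ β ∈ B, 0 < π₀ β) (hπc : ContinuousOn π₀ B)
    (hD : ∀ k, (D k).Admissible F B) (hD₀ : ∀ k, (D₀ k).Admissible F B)
    (hX : ∀ k, (D k).X.rank = p) (hX₀ : ∀ k, (D₀ k).X.rank = p)
    (hn0 : ∀ k, (D k).n ≠ 0) (hn : Tendsto (fun k => (D k).n) atTop atTop)
    {r : ℝ} (hr : 0 < r) (hn₀ : ∀ k, ((D₀ k).n : ℝ) = r * (D k).n)
    (hP : ∀ k, ∀ β ∈ B, scaledInverseHessian F (D k) β = scaledInverseHessian F (D 0) β)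
    (hP₀ : ∀ k, ∀ β ∈ B, scaledInverseHessian F (D₀ k) β = scaledInverseHessian F (D₀ 0) β)
    {b b₀ : EuclideanSpace ℝ (Fin p)} (hb : b ∈ B) (hb₀ : b₀ ∈ B) (hne : b₀ ≠ b)
    (hs : Tendsto (fun k => ((D k).n : ℝ)⁻¹ • (D k).score F b) atTop (𝓝 0))
    (hs₀ : Tendsto (fun k => ((D₀ k).n : ℝ)⁻¹ • (D₀ k).score F b₀) atTop (𝓝 0))
    (hden : ∀ k, ∀ a ∈ Ioc (0 : ℝ) 1,
      IntegrableOn (fun β => likelihood F (D₀ k) β ^ a * π₀ β) B)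
    (hnum : ∀ k, ∀ a ∈ Ioc (0 : ℝ) 1,
      IntegrableOn (fun β => likelihood F (D k) β * (likelihood F (D₀ k) β ^ a * π₀ β)) B)
    {ε : ℝ} (hε : 0 < ε) (hε1 : ε ≤ 1) {κ : ℝ} (hκ : 0 < κ) :
    ∀ᶠ k in atTop, ∀ a ∈ Icc ε 1, ∀ a' ∈ Icc (ε / 4) (ε / 2),
      jointMass F B π₀ (D k) (D₀ k) a / normConst F B π₀ (D₀ k) a ≤
        κ * (jointMass F B π₀ (D k) (D₀ k) a' / normConst F B π₀ (D₀ k) a') := by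
  have hn₀0 : ∀ k, (D₀ k).n ≠ 0 := by
    intro k h0
    have h1 := hn₀ k
    rw [h0, Nat.cast_zero, eq_comm, mul_eq_zero] at h1
    rcases h1 with h1 | h1
    · exact hr.ne' h1
    · exact hn0 k (by exact_mod_cast h1)
  have hden_eq : ∀ k a, ∀ β ∈ B,
      Real.exp (a * ((D₀ k).logLik F β - (D₀ k).logLik F b₀)) * π₀ β =
      Real.exp (-(a * (D₀ k).logLik F b₀)) * (likelihood F (D₀ k) β ^ a * π₀ β) := by
    intro k a β hβ
    rw [Real.rpow_def_of_pos ((hD₀ k).likelihood_pos β), (hD₀ k).log_likelihood hβ, ← mul_assoc,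
      ← Real.exp_add]
    ring_nf
  have hnum_eq : ∀ k a, ∀ β ∈ B,
      Real.exp (((D k).logLik F β - (D k).logLik F b) +
        a * ((D₀ k).logLik F β - (D₀ k).logLik F b₀)) * π₀ β =
      Real.exp (-(D k).logLik F b + -(a * (D₀ k).logLik F b₀)) *
        (likelihood F (D k) β * (likelihood F (D₀ k) β ^ a * π₀ β)) := by
    intro k a β hβ
    have h1 : likelihood F (D k) β = Real.exp ((D k).logLik F β) := by
      rw [← (hD k).log_likelihood hβ, Real.exp_log ((hD k).likelihood_pos β)]
    rw [Real.exp_add, mul_assoc, hden_eq k a β hβ, h1, Real.exp_add, sub_eq_add_neg,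
      Real.exp_add]
    ring
  have key := HasStrictPeak.eventually_expectation_le (μ := volume) hB hπc hπ
    ((hD 0).hasStrictPeak_taylorRemainder (hX 0) (hn0 0) hBc hb)
    ((hD₀ 0).hasStrictPeak_taylorRemainder (hX₀ 0) (hn₀0 0) hBc hb₀) hne
    (((hD₀ 0).hasFDerivAt_taylorRemainder b₀ hb₀).congr_fderiv (sub_self _))
    (n := fun k => ((D k).n : ℝ)) (fun k => by have := hn0 k; positivity)
    (tendsto_natCast_atTop_atTop.comp hn) hs hs₀ hr hε hε1
    (f := fun k β => (D k).logLik F β - (D k).logLik F b)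
    (g := fun k β => (D₀ k).logLik F β - (D₀ k).logLik F b₀)
    (fun k β hβ => by
      rw [Dataset.logLik_sub_eq (hn0 k), (hD k).taylorRemainder_eq (hX k) (hD 0) (hX 0) (hn0 k)
        (hn0 0) hB hBc (hP k) hb hβ])
    (fun k β hβ => by
      rw [Dataset.logLik_sub_eq (hn₀0 k), (hD₀ k).taylorRemainder_eq (hX₀ k) (hD₀ 0) (hX₀ 0)
        (hn₀0 k) (hn₀0 0) hB hBc (hP₀ k) hb₀ hβ, hn₀ k])
    (fun k a ha => IntegrableOn.congr_fun
      ((hden k a ha).const_mul (Real.exp (-(a * (D₀ k).logLik F b₀))))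
      (fun β hβ => (hden_eq k a β hβ).symm) hB.measurableSet)
    (fun k a ha => IntegrableOn.congr_fun ((hnum k a ha).const_mul
      (Real.exp (-(D k).logLik F b + -(a * (D₀ k).logLik F b₀))))
      (fun β hβ => (hnum_eq k a β hβ).symm) hB.measurableSet) hκ
  filter_upwards [key] with k hk a ha a' ha'
  have ha0 : a ∈ Ioc (0 : ℝ) 1 := ⟨hε.trans_le ha.1, ha.2⟩
  have ha'0 : a' ∈ Ioc (0 : ℝ) 1 := ⟨by linarith [ha'.1], by linarith [ha'.2]⟩
  have hpos := (hD₀ k).normConst_pos hB ⟨b, hb⟩ hπ (hden k a ha0)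
  have hpos' := (hD₀ k).normConst_pos hB ⟨b, hb⟩ hπ (hden k a' ha'0)
  have h1 : ∀ t, ∫ β in B, Real.exp (t * ((D₀ k).logLik F β - (D₀ k).logLik F b₀)) * π₀ β =
      Real.exp (-(t * (D₀ k).logLik F b₀)) * normConst F B π₀ (D₀ k) t := fun t => by
    rw [normConst, ← integral_const_mul]
    exact setIntegral_congr_fun hB.measurableSet (hden_eq k t)
  have h2 : ∀ t, ∫ β in B, Real.exp (((D k).logLik F β - (D k).logLik F b) +
      t * ((D₀ k).logLik F β - (D₀ k).logLik F b₀)) * π₀ β =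
      Real.exp (-(D k).logLik F b + -(t * (D₀ k).logLik F b₀)) *
        jointMass F B π₀ (D k) (D₀ k) t := fun t => by
    rw [jointMass, ← integral_const_mul]
    exact setIntegral_congr_fun hB.measurableSet (hnum_eq k t)
  have h3 := hk a ha a' ha'
  -- Centring at `b` and `b₀` contributes the same exponential factors to both sides, and they
  -- cancel.
  rw [h1, h1, h2, h2, Real.exp_add, Real.exp_add] at h3
  have hE : 0 < Real.exp (-(D k).logLik F b) * Real.exp (-(a * (D₀ k).logLik F b₀)) *
    Real.exp (-(a' * (D₀ k).logLik F b₀)) := by positivity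
  have h4 : jointMass F B π₀ (D k) (D₀ k) a * normConst F B π₀ (D₀ k) a' ≤
      κ * (jointMass F B π₀ (D k) (D₀ k) a' * normConst F B π₀ (D₀ k) a) := by
    refine le_of_mul_le_mul_left ?_ hE
    linarith
  rw [← mul_div_assoc, div_le_div_iff₀ hpos hpos']
  linarith

end Concentration

/-! ### Subsequence argument and integration over the beta prior. -/

theorem theorem2p3 {p : ℕ} (F : ExpFamily)
    -- the parameter space and the initial prior
    (B : Set (EuclideanSpace ℝ (Fin p))) (hBopen : IsOpen B) (hBconv : Convex ℝ B)
    (π₀ : EuclideanSpace ℝ (Fin p) → ℝ) (hπ₀pos : ∀ β ∈ B, 0 < π₀ β)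
    (hπ₀smooth : ContDiffOn ℝ 1 π₀ B)
    -- the current and the historical data, along a sequence of sample sizes tending to infinity
    (D D₀ : ℕ → Dataset p)
    (hD : ∀ k, (D k).Admissible F B) (hD₀ : ∀ k, (D₀ k).Admissible F B)
    (hn : Tendsto (fun k => (D k).n) atTop atTop)
    (r : ℝ) (hr : 0 < r) (hn₀ : ∀ k, ((D₀ k).n : ℝ) = r * (D k).n)
    (hX : ∀ k, (D k).X.rank = p) (hX₀ : ∀ k, (D₀ k).X.rank = p)
    -- the power prior can be normalized
    (hc : ∀ k, ∀ a₀ ∈ Ioc (0 : ℝ) 1,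
      IntegrableOn (fun β => likelihood F (D₀ k) β ^ a₀ * π₀ β) B)
    -- the modes, which remain in a compact part of the parameter space
    (K : Set (EuclideanSpace ℝ (Fin p))) (hK : IsCompact K) (hKB : K ⊆ B)
    (βhat : ℕ → EuclideanSpace ℝ (Fin p))
    (hβhat : ∀ k, SolvesModeEquation B (likelihood F (D k)) (βhat k) ∧ βhat k ∈ K)
    (βhat₀ : ℕ → ℝ → EuclideanSpace ℝ (Fin p))
    (hβhat₀ : ∀ a₀ ∈ Ioc (0 : ℝ) 1, ∀ᶠ k in atTop,
      SolvesModeEquation B (powerPrior F B π₀ (D₀ k) a₀) (βhat₀ k a₀) ∧ βhat₀ k a₀ ∈ K)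
    -- the discrepancy of the modes
    (δ : EuclideanSpace ℝ (Fin p)) (hδ : δ ≠ 0)
    (hdiff : ∀ a₀ ∈ Ioc (0 : ℝ) 1,
      Tendsto (fun k => βhat k - βhat₀ k a₀) atTop (𝓝 δ))
    -- the scaled inverse Hessians do not depend on the sample size
    (hHess : ∃ P : EuclideanSpace ℝ (Fin p) → Matrix (Fin p) (Fin p) ℝ,
      ∀ k, ∀ β ∈ B, scaledInverseHessian F (D k) β = P β)
    (hHess₀ : ∃ P₀ : EuclideanSpace ℝ (Fin p) → Matrix (Fin p) (Fin p) ℝ,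
      ∀ k, ∀ β ∈ B, scaledInverseHessian F (D₀ k) β = P₀ β)
    -- the shape parameters of the beta prior
    (α₀ β₀ : ℝ) (hα₀ : 0 < α₀) (hβ₀ : 0 < β₀) :
    (∀ k, IntervalIntegrable (marginalPosterior F B π₀ (D k) (D₀ k) α₀ β₀) volume 0 1 ∧
      0 < ∫ a₀ in (0 : ℝ)..1, marginalPosterior F B π₀ (D k) (D₀ k) α₀ β₀ a₀) ∧
    ∀ ε : ℝ, 0 < ε →
      Tendsto
        (fun k =>
          (∫ a₀ in (0 : ℝ)..ε, marginalPosterior F B π₀ (D k) (D₀ k) α₀ β₀ a₀) /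
            ∫ a₀ in (0 : ℝ)..1, marginalPosterior F B π₀ (D k) (D₀ k) α₀ β₀ a₀)
        atTop (𝓝 1) := by
  have hp : p ≠ 0 := by
    rintro rfl
    exact hδ (Subsingleton.elim _ _)
  have hn0 : ∀ k, (D k).n ≠ 0 := by
    intro k h0
    have h1 := (D k).X.rank_le_height
    rw [hX k, h0] at h1
    omega
  have hn₀0 : ∀ k, (D₀ k).n ≠ 0 := by
    intro k h0
    have h1 := (D₀ k).X.rank_le_height
    rw [hX₀ k, h0] at h1
    omega
  have hπc : ContinuousOn π₀ B := hπ₀smooth.continuousOn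
  obtain ⟨P, hP⟩ := hHess
  obtain ⟨P₀, hP₀⟩ := hHess₀
  have hmode := fun k => (hβhat k).1
  have hint : ∀ k, IntervalIntegrable (marginalPosterior F B π₀ (D k) (D₀ k) α₀ β₀) volume 0 1 :=
    fun k => (hD k).intervalIntegrable_marginalPosterior (hD₀ k) (hX k) (hn0 k) hBopen hBconv
      hπ₀pos hπc (hmode k) (hc k) hα₀ hβ₀
  have hpos : ∀ k, 0 < ∫ a₀ in (0 : ℝ)..1, marginalPosterior F B π₀ (D k) (D₀ k) α₀ β₀ a₀ :=
    fun k => (hD k).integral_marginalPosterior_pos (hD₀ k) (hX k) (hn0 k) hBopen hBconv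
      hπ₀pos hπc (hmode k) (hc k) hα₀ hβ₀
  refine ⟨fun k => ⟨hint k, hpos k⟩, fun ε hε => ?_⟩
  -- For `ε ≥ 1` the quotient is identically one, as the beta density vanishes beyond `1`.
  rcases le_or_gt 1 ε with hε1 | hε1
  · refine tendsto_const_nhds.congr fun k => ?_
    have h0 : EqOn (fun _ => (0 : ℝ)) (marginalPosterior F B π₀ (D k) (D₀ k) α₀ β₀)
        (uIoc 1 ε) := by
      intro a ha
      rw [uIoc_of_le hε1] at ha
      rw [marginalPosterior_eq, ProbabilityTheory.betaPDFReal, if_neg fun h => h.2.not_gt ha.1,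
        mul_zero]
    have h1 : IntervalIntegrable (marginalPosterior F B π₀ (D k) (D₀ k) α₀ β₀) volume 1 ε :=
      intervalIntegrable_const.congr h0
    rw [← intervalIntegral.integral_add_adjacent_intervals (hint k) h1,
      intervalIntegral.integral_zero_ae (ae_of_all _ fun a ha => (h0 ha).symm), add_zero,
      div_self (hpos k).ne']
  have hratio : ∀ κ : ℝ, 0 < κ → ∀ᶠ k in atTop, ∀ a ∈ Icc ε 1, ∀ a' ∈ Icc (ε / 4) (ε / 2),
      jointMass F B π₀ (D k) (D₀ k) a / normConst F B π₀ (D₀ k) a ≤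
        κ * (jointMass F B π₀ (D k) (D₀ k) a' / normConst F B π₀ (D₀ k) a') := by
    intro κ hκ
    -- Failure for infinitely many `k` leaves a subsequence of failures; compactness refines it so
    -- that the current modes converge to `b` and the historical modes at power `1` to `b - δ`.
    by_contra hcon
    obtain ⟨φ, hφ, hφ'⟩ := extraction_of_frequently_atTop (not_eventually.1 hcon)
    obtain ⟨b, hbK, ψ, hψ, hlim⟩ := hK.tendsto_subseq fun j => (hβhat (φ j)).2
    have hθ : StrictMono (φ ∘ ψ) := hφ.comp hψ
    have hθt := hθ.tendsto_atTop
    have h1mem : (1 : ℝ) ∈ Ioc (0 : ℝ) 1 := ⟨one_pos, le_rfl⟩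
    have hmode₀ := hθt.eventually (hβhat₀ 1 h1mem)
    have hlim₀ : Tendsto (fun j => βhat₀ ((φ ∘ ψ) j) 1) atTop (𝓝 (b - δ)) := by
      have h1 := hlim.sub ((hdiff 1 h1mem).comp hθt)
      refine h1.congr fun j => ?_
      simp
    have hb₀K : b - δ ∈ K := hK.isClosed.mem_of_tendsto hlim₀ (hmode₀.mono fun j hj => hj.2)
    have hb := hKB hbK
    have hb₀ := hKB hb₀K
    have hPφ : ∀ j, ∀ β ∈ B, scaledInverseHessian F (D ((φ ∘ ψ) j)) β =
        scaledInverseHessian F (D ((φ ∘ ψ) 0)) β :=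
      fun j β hβ => (hP _ β hβ).trans (hP _ β hβ).symm
    have hP₀φ : ∀ j, ∀ β ∈ B, scaledInverseHessian F (D₀ ((φ ∘ ψ) j)) β =
        scaledInverseHessian F (D₀ ((φ ∘ ψ) 0)) β :=
      fun j β hβ => (hP₀ _ β hβ).trans (hP₀ _ β hβ).symm
    have hs := Dataset.tendsto_score_of_tendsto (D := fun j => D ((φ ∘ ψ) j)) (fun j => hD _)
      (fun j => hX _) (fun j => hn0 _) hBopen hBconv hPφ hb hlim <| by
        refine tendsto_const_nhds.congr fun j => ?_
        have h1 := (hD ((φ ∘ ψ) j)).score_eq_zero hBopen (hmode _)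
        exact ((congrArg _ h1).trans (smul_zero _)).symm
    have hninv : Tendsto (fun k => ((D₀ k).n : ℝ)⁻¹) atTop (𝓝 0) := by
      simp_rw [hn₀]
      exact tendsto_inv_atTop_zero.comp
        ((tendsto_natCast_atTop_atTop.comp hn).const_mul_atTop hr)
    have hlog : ContinuousAt (fderiv ℝ fun β => Real.log (π₀ β)) (b - δ) :=
      ((hπ₀smooth.log fun x hx => (hπ₀pos x hx).ne').continuousOn_fderiv_of_isOpen hBopen
        le_rfl).continuousAt (hBopen.mem_nhds hb₀)
    have hs₀ := Dataset.tendsto_score_of_tendsto (D := fun j => D₀ ((φ ∘ ψ) j)) (fun j => hD₀ _)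
      (fun j => hX₀ _) (fun j => hn₀0 _) hBopen hBconv hP₀φ hb₀ hlim₀ <| by
        have h1 := (hninv.comp hθt).smul (hlog.tendsto.comp hlim₀).neg
        rw [zero_smul] at h1
        refine h1.congr' ?_
        filter_upwards [hmode₀] with j hj
        rw [(hD₀ _).score_eq_neg hBopen hπ₀pos hπ₀smooth (hc _ 1 h1mem) hj.1]
        rfl
    have hev := eventually_jointMass_le (D := fun j => D ((φ ∘ ψ) j))
      (D₀ := fun j => D₀ ((φ ∘ ψ) j)) hBopen hBconv hπ₀pos hπc (fun j => hD _) (fun j => hD₀ _)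
      (fun j => hX _) (fun j => hX₀ _) (fun j => hn0 _) (hn.comp hθt) hr (fun j => hn₀ _) hPφ hP₀φ
      hb hb₀ (by simpa using hδ) hs hs₀ (fun j => hc _)
      (fun j a ha => (hD _).integrableOn_joint (hX _) (hn0 _) hBopen hBconv (hmode _) (hc _ a ha))
      hε hε1.le hκ
    obtain ⟨j, hj⟩ := hev.exists
    exact hφ' (ψ j) hj
  set d := ProbabilityTheory.betaPDFReal α₀ β₀ with hd
  have hdint : Integrable d := ProbabilityTheory.integrable_betaPDFReal hα₀ hβ₀
  have hW : 0 ≤ ∫ a in ε..1, d a :=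
    intervalIntegral.integral_nonneg hε1.le fun a _ =>
      ProbabilityTheory.betaPDFReal_nonneg' hα₀ hβ₀ a
  have hW' : 0 < ∫ a in (ε / 4)..(ε / 2), d a :=
    intervalIntegral.intervalIntegral_pos_of_pos_on hdint.intervalIntegrable
      (fun a ha => ProbabilityTheory.betaPDFReal_pos (by linarith [ha.1]) (by linarith [ha.2])
        hα₀ hβ₀) (by linarith)
  have hsplit : ∀ k, (∫ a₀ in (0 : ℝ)..ε, marginalPosterior F B π₀ (D k) (D₀ k) α₀ β₀ a₀) /
      (∫ a₀ in (0 : ℝ)..1, marginalPosterior F B π₀ (D k) (D₀ k) α₀ β₀ a₀) =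
      1 - (∫ a₀ in ε..1, marginalPosterior F B π₀ (D k) (D₀ k) α₀ β₀ a₀) /
        ∫ a₀ in (0 : ℝ)..1, marginalPosterior F B π₀ (D k) (D₀ k) α₀ β₀ a₀ := by
    intro k
    have h1 : (∫ a₀ in (0 : ℝ)..ε, marginalPosterior F B π₀ (D k) (D₀ k) α₀ β₀ a₀) +
        (∫ a₀ in ε..1, marginalPosterior F B π₀ (D k) (D₀ k) α₀ β₀ a₀) =
        ∫ a₀ in (0 : ℝ)..1, marginalPosterior F B π₀ (D k) (D₀ k) α₀ β₀ a₀ :=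
      intervalIntegral.integral_add_adjacent_intervals
        ((hint k).mono_set (by
          rw [uIcc_of_le hε.le, uIcc_of_le zero_le_one]; exact Icc_subset_Icc le_rfl hε1.le))
        ((hint k).mono_set (by
          rw [uIcc_of_le hε1.le, uIcc_of_le zero_le_one]; exact Icc_subset_Icc hε.le le_rfl))
    rw [eq_sub_iff_add_eq, ← add_div, h1, div_self (hpos k).ne']
  simp_rw [hsplit]
  have hnonneg : ∀ k, ∀ a ∈ Ioc (0 : ℝ) 1,
      0 ≤ jointMass F B π₀ (D k) (D₀ k) a / normConst F B π₀ (D₀ k) a * d a := fun k a ha =>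
    mul_nonneg (div_pos ((hD k).jointMass_pos (hD₀ k) (hX k) (hn0 k) hBopen hBconv hπ₀pos
      (hmode k) (hc k a ha)) ((hD₀ k).normConst_pos hBopen ⟨_, (hmode k).1⟩ hπ₀pos
      (hc k a ha))).le (ProbabilityTheory.betaPDFReal_nonneg' hα₀ hβ₀ a)
  have htail : Tendsto (fun k =>
      (∫ a₀ in ε..1, marginalPosterior F B π₀ (D k) (D₀ k) α₀ β₀ a₀) /
        ∫ a₀ in (0 : ℝ)..1, marginalPosterior F B π₀ (D k) (D₀ k) α₀ β₀ a₀) atTop (𝓝 0) := by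
    refine tendsto_order.2 ⟨fun x hx => Eventually.of_forall fun k => hx.trans_le ?_,
      fun e he => ?_⟩
    · refine div_nonneg (intervalIntegral.integral_nonneg hε1.le fun a ha => ?_) (hpos k).le
      rw [marginalPosterior_eq]
      exact hnonneg k a ⟨hε.trans_le ha.1, ha.2⟩
    · set W := ∫ a in ε..1, d a
      set W' := ∫ a in (ε / 4)..(ε / 2), d a
      -- This `κ` makes `κ W < e W'`; the added `1` gives strictness from `W ≥ 0` alone.
      filter_upwards [hratio (e * W' / (W + 1)) (by positivity)] with k hk
      have hposk := hpos k
      have hintk := hint k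
      simp_rw [funext fun a => marginalPosterior_eq (F := F) (B := B) (π₀ := π₀) (D := D k)
        (D₀ := D₀ k) α₀ β₀ a] at hposk hintk ⊢
      have h1 := integral_tail_mul_le hε hε1.le (by positivity)
        (ProbabilityTheory.betaPDFReal_nonneg' hα₀ hβ₀) hdint.intervalIntegrable hintk
        (hnonneg k) hk
      rw [div_lt_iff₀ hposk]
      refine lt_of_mul_lt_mul_right (h1.trans_lt ?_) hW'.le
      have h2 : e * W' / (W + 1) * W < e * W' := by
        rw [div_mul_eq_mul_div, div_lt_iff₀ (by positivity)]
        have := mul_pos he hW'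
        linarith
      have h3 := mul_lt_mul_of_pos_right h2 hposk
      linarith
  simpa using htail.const_sub 1
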